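/- A \emph{piecewise Euclidean triangle complex} $X$ is a (possibly infinite) 2-dimensional simplicial complex in which every triangle carries the metric of a nondegenerate Euclidean triangle with geodesic sides and every edge the metric of an interval, these metrics agreeing on common faces. $X$ is equipped with the quotient pseudometric (the infimum of lengths of strings of points, consecutive ones lying in a common closed simplex), and it is assumed that for each metric ball $B$ the simplices of $X$ intersecting $B$ have only finitely many isometry types. A path $\gamma\colon[a,b]\to X$ \emph{starts} (resp. \emph{ends}) in a triangle $T$ if for some $\varepsilon>0$ all points $\gamma(t)$ with $a<t<a+\varepsilon\le b$ (resp. $a\le b-\varepsilon<t<b$) lie in the interior of $T$. If in addition $\gamma(a)$ (resp. $\gamma(b)$) lies in the interior of an edge $e$ of $T$, then $\gamma$ starts (resp. ends) \emph{perpendicularly to $e$} in $T$ if the angle in $T$ between $\gamma$ and $e$ at that point is $\frac{\pi}{2}$. A \emph{sheared geodesic} in $X$ is a concatenation $\gamma=\gamma_1\cdot\gamma_2\cdots\gamma_{2k-1}\cdot\gamma_{2k}$ ($k\ge 1$) of geodesics of $X$ such that, for some edges $e_1,\dots,e_k$ of $X$: \begin{itemize} \item for $i=1,\dots,k$, the (possibly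 trivial) geodesic $\gamma_{2i}$ lies in the interior of the edge $e_i$; \item for $i=1,\dots,k-1$, the geodesic $\gamma_{2i-1}$ ends perpendicularly to $e_i$ in a triangle of $X$, and $\gamma_{2i+1}$ starts perpendicularly to $e_i$ in a triangle of $X$ distinct from it; and $\gamma_{2k-1}$ ends perpendicularly to $e_k$ in a triangle of $X$. \end{itemize} \textbf{Proposition.} Let $X$ be a piecewise Euclidean triangle complex that is $\mathrm{CAT}(0)$, and let $\gamma$ be a sheared geodesic in $X$. Then $\gamma$ is not a closed path, i.e. its starting point and its endpoint are distinct. -/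

import Mathlib

open Set Filter Topology
open scoped ENNReal

noncomputable section

/-! ### Geodesics and CAT(0) spaces -/

/-- The restriction of `c` to `[a, b]` is a geodesic: an isometric embedding of `[a, b]`.
The case `a = b` (a trivial geodesic) is allowed. -/
def IsGeodesic {Y : Type*} [PseudoEMetricSpace Y] (c : ℝ → Y) (a b : ℝ) : Prop :=
  a ≤ b ∧ ∀ s ∈ Icc a b, ∀ t ∈ Icc a b, edist (c s) (c t) = ENNReal.ofReal |s - t|

/-- The path `c` on `[a, b]` is closed. -/
def IsClosedPath {Y : Type*} (c : ℝ → Y) (a b : ℝ) : Prop := c a = c b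

/-- A CAT(0) space: a geodesic metric space in which every geodesic triangle satisfies the
comparison inequality. In `comparison` the vertices of the geodesic triangle are
`c 0 = c' 0`, `c L` and `c' L'`, with comparison triangle `p, q, r` in the Euclidean plane, and
`c s`, `c' t` are arbitrary points on two sides, with comparison points `x`, `y`. -/
structure IsCAT0 (Y : Type*) [PseudoEMetricSpace Y] : Prop where
  eq_of_edist_eq_zero : ∀ x y : Y, edist x y = 0 → x = y
  exists_geodesic : ∀ x y : Y, ∃ (c : ℝ → Y) (L : ℝ), IsGeodesic c 0 L ∧ c 0 = x ∧ c L = y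
  comparison : ∀ (c c' : ℝ → Y) (L L' : ℝ), IsGeodesic c 0 L → IsGeodesic c' 0 L' → c 0 = c' 0 →
    ∀ p q r : EuclideanSpace ℝ (Fin 2), dist p q = L → dist p r = L' →
      edist (c L) (c' L') = ENNReal.ofReal (dist q r) →
    ∀ s ∈ Icc 0 L, ∀ t ∈ Icc 0 L', ∀ x y : EuclideanSpace ℝ (Fin 2),
      dist p x = s → dist x q = L - s → dist p y = t → dist y r = L' - t →
      edist (c s) (c' t) ≤ ENNReal.ofReal (dist x y)

/-! ### Piecewise Euclidean triangle complexes -/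

/-- A 2-dimensional simplicial complex (possibly infinite, possibly not locally finite) with
vertex set `V`, each of whose triangles is given the metric of a nondegenerate Euclidean triangle,
and each of whose edges is given the metric of an interval, in such a way that the metrics agree
on common faces. Such a metric is the same as a positive length for every edge, subject to the
strict triangle inequality in every triangle. The values of `len u v` for distinct `u, v` not
spanning an edge are irrelevant. -/
structure EuclideanTriangleComplex (V : Type*) extends AbstractSimplicialComplex V where
  card_le_three : ∀ σ ∈ faces, σ.card ≤ 3
  len : V → V → ℝ
  len_self : ∀ v, len v v = 0
  len_symm : ∀ u v, len u v = len v u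
  len_pos : ∀ σ ∈ faces, ∀ u ∈ σ, ∀ v ∈ σ, u ≠ v → 0 < len u v
  len_triangle : ∀ σ ∈ faces, ∀ u ∈ σ, ∀ v ∈ σ, ∀ w ∈ σ, u ≠ v → v ≠ w → u ≠ w →
    len u w < len u v + len v w

namespace EuclideanTriangleComplex

variable {V : Type*}

/-- The points of the complex, in barycentric coordinates. -/
@[ext]
structure Realization (X : EuclideanTriangleComplex V) where
  coord : V →₀ ℝ
  nonneg : ∀ v, 0 ≤ coord v
  sum_eq_one : (coord.sum fun _ a => a) = 1
  support_mem : coord.support ∈ X.faces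

variable (X : EuclideanTriangleComplex V)

variable {X}

/-- The vertices with nonzero barycentric coordinate. A point `x` lies in the closed simplex `σ`
iff `x.supp ⊆ σ`, and in the interior of the simplex `σ` iff `x.supp = σ`. -/
def Realization.supp (x : X.Realization) : Finset V := x.coord.support

variable (X)

/-- A vertex as a point of the complex. -/
def vertexPoint (v : V) : X.Realization :=
  ⟨Finsupp.single v 1, fun w => by
      classical
      rw [Finsupp.single_apply]; split_ifs <;> norm_num,
    by simp, by
      rw [Finsupp.support_single _ one_ne_zero]; exact X.singleton_mem v⟩

variable {X}

/-- The Euclidean distance of two points of a common closed simplex: in terms of the difference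
`u` of their barycentric coordinates, its square is `-½ ∑ᵢ ∑ⱼ |ij|² uᵢ uⱼ`. -/
def simplexDist (x y : X.Realization) : ℝ :=
  √(-(1 / 2) * ((x.coord - y.coord).sum fun i a =>
    (x.coord - y.coord).sum fun j b => X.len i j ^ 2 * a * b))

/-- The Euclidean angle at `x` between the segments `xy` and `xz`, for points `x, y, z` of a common
closed simplex with `y ≠ x ≠ z` (by the law of cosines). -/
def simplexAngle (x y z : X.Realization) : ℝ :=
  Real.arccos ((simplexDist x y ^ 2 + simplexDist x z ^ 2 - simplexDist y z ^ 2) /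
    (2 * simplexDist x y * simplexDist x z))

/-- `p 0, …, p n` is a string from `x` to `y`: any two consecutive points lie in a common closed
simplex. -/
def IsString (x y : X.Realization) (n : ℕ) (p : ℕ → X.Realization) : Prop :=
  p 0 = x ∧ p n = y ∧ ∀ i < n, ∃ σ ∈ X.faces, (p i).supp ⊆ σ ∧ (p (i + 1)).supp ⊆ σ

/-- The length of a string. -/
def stringLength (n : ℕ) (p : ℕ → X.Realization) : ℝ≥0∞ :=
  ∑ i ∈ Finset.range n, ENNReal.ofReal (simplexDist (p i) (p (i + 1)))

/-- The quotient pseudometric obtained by gluing the simplices: the infimum of the lengths of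
strings (`∞` for points in distinct connected components). -/
def glueDist (x y : X.Realization) : ℝ≥0∞ :=
  ⨅ (n : ℕ) (p : ℕ → X.Realization) (_ : IsString x y n p), stringLength n p

theorem simplexDist_comm (x y : X.Realization) : simplexDist x y = simplexDist y x := by
  have h : x.coord - y.coord = -(y.coord - x.coord) := by simp
  unfold simplexDist
  rw [h]
  simp only [Finsupp.sum, Finsupp.support_neg, Finsupp.neg_apply, mul_neg, neg_mul, neg_neg]

theorem IsString.glueDist_le {x y : X.Realization} {n : ℕ} {p : ℕ → X.Realization}
    (h : IsString x y n p) : glueDist x y ≤ stringLength n p :=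
  iInf_le_of_le n <| iInf_le_of_le p <| iInf_le_of_le h le_rfl

theorem glueDist_le_symm (x y : X.Realization) : glueDist y x ≤ glueDist x y := by
  refine le_iInf fun n => le_iInf fun p => le_iInf fun hp => ?_
  obtain ⟨h0, hn, h⟩ := hp
  refine (IsString.glueDist_le (n := n) (p := fun i => p (n - i))
    ⟨by simpa using hn, by simpa using h0, fun i hi => ?_⟩).trans ?_
  · obtain ⟨σ, hσ, h1, h2⟩ := h (n - (i + 1)) (by omega)
    rw [show n - (i + 1) + 1 = n - i by omega] at h2
    exact ⟨σ, hσ, h2, h1⟩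
  · unfold stringLength
    rw [← Finset.sum_range_reflect]
    refine le_of_eq (Finset.sum_congr rfl fun i hi => ?_)
    have hi := Finset.mem_range.1 hi
    dsimp only
    rw [show n - (n - 1 - i) = i + 1 by omega, show n - (n - 1 - i + 1) = i by omega,
      simplexDist_comm]

theorem glueDist_triangle (x y z : X.Realization) :
    glueDist x z ≤ glueDist x y + glueDist y z := by
  suffices key : ∀ n p, IsString x y n p → ∀ m q, IsString y z m q →
      glueDist x z ≤ stringLength n p + stringLength m q by
    conv_rhs => unfold glueDist
    simp only [ENNReal.iInf_add, ENNReal.add_iInf]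
    exact le_iInf fun m => le_iInf fun q => le_iInf fun hq => le_iInf fun n => le_iInf fun p =>
      le_iInf fun hp => key n p hp m q hq
  intro n p hp m q hq
  obtain ⟨p0, pn, hp⟩ := hp
  obtain ⟨q0, qm, hq⟩ := hq
  set c : ℕ → X.Realization := fun i => if i ≤ n then p i else q (i - n) with hc
  have c1 : ∀ i ≤ n, c i = p i := fun i hi => by simp [hc, hi]
  have c2 : ∀ i, c (n + i) = q i := fun i => by
    rcases Nat.eq_zero_or_pos i with rfl | hi
    · simp [hc, pn, q0]
    · simp [hc, show ¬ i = 0 by omega]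
  refine (IsString.glueDist_le (n := n + m) (p := c)
    ⟨by rw [c1 0 (Nat.zero_le _), p0], by rw [c2, qm], fun i hi => ?_⟩).trans ?_
  · rcases lt_or_ge i n with h | h
    · rw [c1 i h.le, c1 (i + 1) h]; exact hp i h
    · obtain ⟨j, rfl⟩ := Nat.exists_eq_add_of_le h
      rw [c2, add_assoc, c2]; exact hq j (by omega)
  · unfold stringLength
    rw [Finset.sum_range_add]
    refine le_of_eq (congrArg₂ (· + ·) (Finset.sum_congr rfl fun i hi => ?_)
      (Finset.sum_congr rfl fun i hi => ?_))
    · have hi := Finset.mem_range.1 hi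
      rw [c1 i hi.le, c1 (i + 1) hi]
    · rw [c2, add_assoc, c2]

instance : PseudoEMetricSpace X.Realization where
  edist := glueDist
  edist_self x := le_antisymm
    (iInf_le_of_le 0 <| iInf_le_of_le (fun _ => x) <| iInf_le_of_le
      ⟨rfl, rfl, fun i hi => absurd hi (Nat.not_lt_zero i)⟩ (by simp [stringLength])) zero_le
  edist_comm x y := le_antisymm (glueDist_le_symm y x) (glueDist_le_symm x y)
  edist_triangle := glueDist_triangle

variable (X)

/-- Two simplices have the same isometry type. (An isometry of Euclidean simplices is the same as
a bijection of their vertices that preserves the edge lengths.) -/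
def SameShape (σ τ : Finset V) : Prop :=
  ∃ f : σ ≃ τ, ∀ i j : σ, X.len (f i) (f j) = X.len i j

/-- For each metric ball, the simplices intersecting it have only finitely many isometry types. -/
def FiniteShapesInBalls : Prop :=
  ∀ (x : X.Realization) (r : ℝ), ∃ F : Set (Finset V), F.Finite ∧
    ∀ σ ∈ X.faces, (∃ y : X.Realization, y.supp ⊆ σ ∧ edist x y < ENNReal.ofReal r) →
      ∃ τ ∈ F, τ ∈ X.faces ∧ X.SameShape σ τ

/-! ### Sheared geodesics -/

/-- `e` is an edge of `X`. -/
def IsEdge (e : Finset V) : Prop := e ∈ X.faces ∧ e.card = 2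

/-- `T` is a triangle of `X`. -/
def IsTriangle (T : Finset V) : Prop := T ∈ X.faces ∧ T.card = 3

variable {X}

/-- The path `c` on `[a, b]` starts in the simplex `σ`. -/
def StartsIn (c : ℝ → X.Realization) (a b : ℝ) (σ : Finset V) : Prop :=
  ∃ ε > 0, a + ε ≤ b ∧ ∀ t ∈ Ioo a (a + ε), (c t).supp = σ

/-- The path `c` on `[a, b]` ends in the simplex `σ`. -/
def EndsIn (c : ℝ → X.Realization) (a b : ℝ) (σ : Finset V) : Prop :=
  ∃ ε > 0, a ≤ b - ε ∧ ∀ t ∈ Ioo (b - ε) b, (c t).supp = σ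

/-- The path `c` on `[a, b]` starts perpendicularly to the edge `e` in the triangle `T`: it starts
in `T` at a point of the interior of `e`, and the angle at `c a` between `c` and `e` is `π / 2`.
The angle is the one in the link of `c a`, i.e. the angle of the starting direction of `c` in the
Euclidean triangle `T` with the two directions of `e` at `c a`. -/
def StartsPerpendicularly (c : ℝ → X.Realization) (a b : ℝ) (e T : Finset V) : Prop :=
  (c a).supp = e ∧ X.IsTriangle T ∧ e ⊆ T ∧ StartsIn c a b T ∧
    ∀ v ∈ e, Tendsto (fun t => simplexAngle (c a) (c t) (X.vertexPoint v)) (𝓝[>] a)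
      (𝓝 (Real.pi / 2))

/-- The path `c` on `[a, b]` ends perpendicularly to the edge `e` in the triangle `T`. -/
def EndsPerpendicularly (c : ℝ → X.Realization) (a b : ℝ) (e T : Finset V) : Prop :=
  (c b).supp = e ∧ X.IsTriangle T ∧ e ⊆ T ∧ EndsIn c a b T ∧
    ∀ v ∈ e, Tendsto (fun t => simplexAngle (c b) (c t) (X.vertexPoint v)) (𝓝[<] b)
      (𝓝 (Real.pi / 2))

/-- The path `γ` on `[a, b]` is a sheared geodesic, i.e. a concatenation `γ₁ · γ₂ ⋯ γ₂ₖ` of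
geodesics with `k ≥ 1`, where `γⱼ` is the restriction of `γ` to `[t (j - 1), t j]`, such that
* for `i = 1, …, k` the (possibly trivial) geodesic `γ₂ᵢ` lies in the interior of an edge `eᵢ`
  (called `e (i - 1)` below),
* for `i = 1, …, k - 1` the geodesic `γ₂ᵢ₋₁` ends and `γ₂ᵢ₊₁` starts perpendicularly to `eᵢ`
  in distinct triangles,
* `γ₂ₖ₋₁` ends perpendicularly to `eₖ` in a triangle. -/
def IsShearedGeodesic (γ : ℝ → X.Realization) (a b : ℝ) : Prop :=
  ∃ (k : ℕ) (t : ℕ → ℝ) (e : ℕ → Finset V), 1 ≤ k ∧ t 0 = a ∧ t (2 * k) = b ∧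
    (∀ j < 2 * k, IsGeodesic γ (t j) (t (j + 1))) ∧
    (∀ i < k, X.IsEdge (e i) ∧ ∀ s ∈ Icc (t (2 * i + 1)) (t (2 * i + 2)), (γ s).supp = e i) ∧
    (∀ i, i + 1 < k → ∃ T T' : Finset V, T ≠ T' ∧
      EndsPerpendicularly γ (t (2 * i)) (t (2 * i + 1)) (e i) T ∧
      StartsPerpendicularly γ (t (2 * i + 2)) (t (2 * i + 3)) (e i) T') ∧
    (∀ i, i + 1 = k → ∃ T : Finset V,
      EndsPerpendicularly γ (t (2 * i)) (t (2 * i + 1)) (e i) T)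

end EuclideanTriangleComplex

end

/-!
Let `x₀` be the starting point of the sheared geodesic `γ`. The idea is to follow, along `γ`, the
direction in which the geodesic back to `x₀` sets off. Write `T i` for the triangle in which the
`i`-th transversal piece of `γ` arrives at the edge `e i`. The invariant is that from every point of
`γ` on `e i` the geodesic to `x₀` is nontrivial and starts in `T i` (`HeadsInto`). At the endpoint
of `γ` this says in particular that the endpoint is not `x₀`.

At the first edge the geodesic back to `x₀` is the first piece of `γ` itself. While `γ` slides along
an edge, the invariant persists (`HeadsInto.slide`): the set of points of the interior of an edge
from which the geodesic to `x₀` starts in a given triangle is open and closed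
(`exists_forall_headsInto_iff`). It is open since geodesics depend continuously on their endpoints.
Its complement is open as well; the interesting case is that of a point from which the geodesic to
`x₀` starts along the edge. Then the same holds at all nearby points of the edge, as a local
geodesic in a CAT(0) space is a geodesic.

When `γ` crosses from `e i` to the next edge (`HeadsInto.cross`), it leaves `e i` perpendicularly
and on another side than the geodesic to `x₀`, so the angle between the two is at least `π / 2`. If
the geodesic to `x₀` from the next edge did not start in the triangle in which `γ` arrives there,
then the angle between the two would be at least `π / 2` there as well, and a geodesic triangle in a
CAT(0) space does not have two such angles (`StartsPerpendicularly.sq_add_sq_le`).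

The local geometry at an interior point of an edge comes from the maps `chart`, which develop one
triangle at the edge into the upper half plane and fold all others into the lower one. They preserve
distances in each closed simplex that contains the edge. A string that leaves the star of the edge
has at least a fixed length, because the triangles at the edge have finitely many shapes
(`FiniteShapesInBalls.exists_radius`). Hence near the given point the charts do not increase
distances (`exists_isChartRadius`), and geodesics from points of the edge are developed to straight
segments.
-/

noncomputable section

/-! ### Comparison in CAT(0) spaces -/

/-- The distance of two points of an extended pseudometric space as a real number; it takes the
junk value `0` at infinite distance, which does not occur in a CAT(0) space. -/
def rdist {Y : Type*} [PseudoEMetricSpace Y] (x y : Y) : ℝ := (edist x y).toReal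

section CAT0

variable {Y : Type*} [PseudoEMetricSpace Y]

theorem rdist_nonneg (x y : Y) : 0 ≤ rdist x y := ENNReal.toReal_nonneg

theorem rdist_comm (x y : Y) : rdist x y = rdist y x := by rw [rdist, edist_comm, rdist]

theorem rdist_self (x : Y) : rdist x x = 0 := by simp [rdist]

theorem IsGeodesic.rdist_eq {c : ℝ → Y} {a b : ℝ} (hc : IsGeodesic c a b) {s t : ℝ}
    (hs : s ∈ Icc a b) (ht : t ∈ Icc a b) : rdist (c s) (c t) = |s - t| := by
  rw [rdist, hc.2 s hs t ht, ENNReal.toReal_ofReal (abs_nonneg _)]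

theorem IsGeodesic.rdist_zero_eq {c : ℝ → Y} {L : ℝ} (hc : IsGeodesic c 0 L) {t : ℝ}
    (ht : t ∈ Icc 0 L) : rdist (c 0) (c t) = t := by
  rw [hc.rdist_eq ⟨le_rfl, hc.1⟩ ht, zero_sub, abs_neg, abs_of_nonneg ht.1]

/-- The restriction of a path to `[a, b]`, reparametrized by `[0, b - a]`. -/
theorem IsGeodesic.shift {c : ℝ → Y} {a b : ℝ} (hc : IsGeodesic c a b) :
    IsGeodesic (fun s => c (a + s)) 0 (b - a) := by
  refine ⟨sub_nonneg.2 hc.1, fun s hs t ht => ?_⟩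
  rw [hc.2 _ ⟨by linarith [hs.1], by linarith [hs.2]⟩ _ ⟨by linarith [ht.1], by linarith [ht.2]⟩]
  congr 2; ring

theorem IsGeodesic.reverse {c : ℝ → Y} {a b : ℝ} (hc : IsGeodesic c a b) :
    IsGeodesic (fun s => c (b - s)) 0 (b - a) := by
  refine ⟨sub_nonneg.2 hc.1, fun s hs t ht => ?_⟩
  rw [hc.2 _ ⟨by linarith [hs.2], by linarith [hs.1]⟩ _ ⟨by linarith [ht.2], by linarith [ht.1]⟩,
    ← abs_neg]
  congr 2; ring

theorem IsCAT0.edist_ne_top (h : IsCAT0 Y) (x y : Y) : edist x y ≠ ⊤ := by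
  obtain ⟨c, L, hc, rfl, rfl⟩ := h.exists_geodesic x y
  rw [hc.2 0 ⟨le_rfl, hc.1⟩ L ⟨hc.1, le_rfl⟩]
  exact ENNReal.ofReal_ne_top

theorem IsCAT0.edist_eq (h : IsCAT0 Y) (x y : Y) : edist x y = ENNReal.ofReal (rdist x y) :=
  (ENNReal.ofReal_toReal (h.edist_ne_top x y)).symm

theorem IsCAT0.rdist_triangle (h : IsCAT0 Y) (x y z : Y) :
    rdist x z ≤ rdist x y + rdist y z := by
  unfold rdist
  rw [← ENNReal.toReal_add (h.edist_ne_top x y) (h.edist_ne_top y z)]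
  exact ENNReal.toReal_mono (ENNReal.add_ne_top.2 ⟨h.edist_ne_top x y, h.edist_ne_top y z⟩)
    (edist_triangle x y z)

theorem IsCAT0.eq_of_rdist_eq_zero (h : IsCAT0 Y) {x y : Y} (hxy : rdist x y = 0) : x = y :=
  h.eq_of_edist_eq_zero x y (by rw [h.edist_eq, hxy, ENNReal.ofReal_zero])

theorem IsCAT0.rdist_pos (h : IsCAT0 Y) {x y : Y} (hxy : x ≠ y) : 0 < rdist x y :=
  (rdist_nonneg x y).lt_of_ne' fun h0 => hxy (h.eq_of_rdist_eq_zero h0)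

theorem IsCAT0.exists_isGeodesic (h : IsCAT0 Y) (x y : Y) :
    ∃ c : ℝ → Y, IsGeodesic c 0 (rdist x y) ∧ c 0 = x ∧ c (rdist x y) = y := by
  obtain ⟨c, L, hc, rfl, rfl⟩ := h.exists_geodesic x y
  have hL : rdist (c 0) (c L) = L := hc.rdist_zero_eq ⟨hc.1, le_rfl⟩
  exact ⟨c, by rwa [hL], rfl, by rw [hL]⟩

/-- Comparison triangles exist: one vertex is at the origin. -/
theorem exists_euclidean_triangle {L L' D : ℝ} (hL : 0 < L) (hL' : 0 ≤ L') (hD : 0 ≤ D)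
    (h1 : D ≤ L + L') (h2 : L ≤ L' + D) (h3 : L' ≤ L + D) :
    ∃ q r : EuclideanSpace ℝ (Fin 2), ‖q‖ = L ∧ ‖r‖ = L' ∧ dist q r = D := by
  -- the vertex `r` has first coordinate `x`, the projection of the side `L'` to the side `L`
  set x := (L ^ 2 + L' ^ 2 - D ^ 2) / (2 * L) with hx
  have hxL : 2 * L * x = L ^ 2 + L' ^ 2 - D ^ 2 := by rw [hx]; field_simp
  have hle : x ^ 2 ≤ L' ^ 2 := by
    refine sq_le_sq' ?_ ?_
    · nlinarith
    · nlinarith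
  have hy : √(L' ^ 2 - x ^ 2) ^ 2 = L' ^ 2 - x ^ 2 := Real.sq_sqrt (sub_nonneg.2 hle)
  refine ⟨!₂[L, 0], !₂[x, √(L' ^ 2 - x ^ 2)], ?_, ?_, ?_⟩
  · simp [EuclideanSpace.norm_eq, hL.le]
  · simp only [EuclideanSpace.norm_eq, Fin.sum_univ_two, Real.norm_eq_abs, sq_abs,
      Matrix.cons_val_zero, Matrix.cons_val_one]
    rw [hy, add_sub_cancel, Real.sqrt_sq hL']
  · simp only [EuclideanSpace.dist_eq, Fin.sum_univ_two, Real.dist_eq, sq_abs,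
      Matrix.cons_val_zero, Matrix.cons_val_one]
    rw [show (L - x) ^ 2 + (0 - √(L' ^ 2 - x ^ 2)) ^ 2 = D ^ 2 by
      rw [zero_sub, neg_sq, hy]; linear_combination -hxL, Real.sqrt_sq hD]

/-- The CAT(0) inequality in algebraic form: the right hand side is `L * L'` times the squared
distance of the comparison points, by the law of cosines. -/
theorem IsCAT0.comparison_sq (h : IsCAT0 Y) {c c' : ℝ → Y} {L L' : ℝ} (hL : 0 < L) (hL' : 0 < L')
    (hc : IsGeodesic c 0 L) (hc' : IsGeodesic c' 0 L') (h0 : c 0 = c' 0) {s t : ℝ}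
    (hs : s ∈ Icc 0 L) (ht : t ∈ Icc 0 L') :
    L * L' * rdist (c s) (c' t) ^ 2 ≤
      L * L' * (s ^ 2 + t ^ 2) - s * t * (L ^ 2 + L' ^ 2 - rdist (c L) (c' L') ^ 2) := by
  have e1 : rdist (c 0) (c L) = L := hc.rdist_zero_eq ⟨hL.le, le_rfl⟩
  have e2 : rdist (c 0) (c' L') = L' := h0 ▸ hc'.rdist_zero_eq ⟨hL'.le, le_rfl⟩
  have t1 := h.rdist_triangle (c L) (c 0) (c' L')
  have t2 := h.rdist_triangle (c 0) (c' L') (c L)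
  have t3 := h.rdist_triangle (c 0) (c L) (c' L')
  rw [rdist_comm (c L) (c 0)] at t1
  rw [rdist_comm (c' L') (c L)] at t2
  rw [e1, e2] at t1 t2 t3
  -- the comparison points are `(s / L) • q` and `(t / L') • r`
  obtain ⟨q, r, hq, hr, hqr⟩ := exists_euclidean_triangle hL hL'.le (rdist_nonneg _ _) t1 t2 t3
  have aux : ∀ {l s : ℝ} {q : EuclideanSpace ℝ (Fin 2)}, 0 < l → s ∈ Icc 0 l → ‖q‖ = l →
      dist 0 ((s / l) • q) = s ∧ dist ((s / l) • q) q = l - s := by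
    intro l s q hl hs hq
    constructor
    · rw [dist_zero_left, norm_smul, hq, Real.norm_eq_abs, abs_of_nonneg (div_nonneg hs.1 hl.le),
        div_mul_cancel₀ _ hl.ne']
    · rw [dist_eq_norm, show (s / l) • q - q = (s / l - 1) • q by rw [sub_smul, one_smul],
        norm_smul, hq, Real.norm_eq_abs, abs_of_nonpos (sub_nonpos.2 ((div_le_one hl).2 hs.2))]
      field_simp; ring
  have key := h.comparison c c' L L' hc hc' h0 0 q r (by rw [dist_zero_left, hq])
    (by rw [dist_zero_left, hr]) (by rw [hqr, h.edist_eq]) s hs t ht ((s / L) • q) ((t / L') • r)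
    (aux hL hs hq).1 (aux hL hs hq).2 (aux hL' ht hr).1 (aux hL' ht hr).2
  rw [h.edist_eq, ENNReal.ofReal_le_ofReal_iff dist_nonneg] at key
  have hin : inner ℝ q r = (L ^ 2 + L' ^ 2 - rdist (c L) (c' L') ^ 2) / 2 := by
    have := norm_sub_sq_real q r
    rw [← dist_eq_norm, hqr, hq, hr] at this
    linarith
  have hd : dist ((s / L) • q) ((t / L') • r) ^ 2 =
      s ^ 2 + t ^ 2 - s / L * (t / L') * (L ^ 2 + L' ^ 2 - rdist (c L) (c' L') ^ 2) := by
    rw [dist_eq_norm, norm_sub_sq_real, inner_smul_left, inner_smul_right, hin, norm_smul,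
      norm_smul, hq, hr, mul_pow, mul_pow, Real.norm_eq_abs, Real.norm_eq_abs, sq_abs, sq_abs]
    simp only [conj_trivial]
    field_simp
    ring
  have k2 : rdist (c s) (c' t) ^ 2 ≤ dist ((s / L) • q) ((t / L') • r) ^ 2 :=
    pow_le_pow_left₀ (rdist_nonneg _ _) key 2
  rw [hd] at k2
  calc _ ≤ L * L' * (s ^ 2 + t ^ 2 -
        s / L * (t / L') * (L ^ 2 + L' ^ 2 - rdist (c L) (c' L') ^ 2)) :=
        mul_le_mul_of_nonneg_left k2 (mul_pos hL hL').le
    _ = _ := by field_simp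

/-- A geodesic passes through every point lying metrically between its endpoints. -/
theorem IsCAT0.apply_rdist_eq (h : IsCAT0 Y) {c : ℝ → Y} {L : ℝ} (hc : IsGeodesic c 0 L) {y : Y}
    (hy : rdist (c 0) y + rdist y (c L) = L) : c (rdist (c 0) y) = y := by
  rcases (rdist_nonneg (c 0) y).eq_or_lt with h0 | h0
  · rw [← h0]; exact h.eq_of_rdist_eq_zero h0.symm
  obtain ⟨c', hc', h1, h2⟩ := h.exists_isGeodesic (c 0) y
  set t := rdist (c 0) y with ht
  have hn := rdist_nonneg y (c L)
  have hL : 0 < L := by linarith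
  have key := h.comparison_sq hL h0 hc hc' h1.symm (s := t) (t := t) ⟨h0.le, by linarith⟩
    ⟨h0.le, le_rfl⟩
  rw [h2, rdist_comm (c L) y, show rdist y (c L) = L - t by linarith] at key
  have : L * t * rdist (c t) y ^ 2 ≤ 0 := by nlinarith
  have h3 : rdist (c t) y ^ 2 ≤ 0 := nonpos_of_mul_nonpos_right this (mul_pos hL h0)
  exact h.eq_of_rdist_eq_zero (pow_eq_zero_iff two_ne_zero |>.1 (le_antisymm h3 (sq_nonneg _)))

theorem IsCAT0.geodesic_unique (h : IsCAT0 Y) {c c' : ℝ → Y} {L L' : ℝ} (hc : IsGeodesic c 0 L)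
    (hc' : IsGeodesic c' 0 L') (h0 : c 0 = c' 0) (h1 : c L = c' L') :
    L = L' ∧ ∀ t ∈ Icc 0 L, c t = c' t := by
  have e1 : rdist (c 0) (c L) = L := hc.rdist_zero_eq ⟨hc.1, le_rfl⟩
  have e2 : rdist (c' 0) (c' L') = L' := hc'.rdist_zero_eq ⟨hc'.1, le_rfl⟩
  have hLL : L = L' := by rw [← e1, ← e2, h0, h1]
  subst hLL
  refine ⟨rfl, fun t ht => ?_⟩
  have e3 := hc'.rdist_zero_eq ht
  have e4 := hc'.rdist_eq ht ⟨hc.1, le_rfl⟩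
  have := h.apply_rdist_eq hc (y := c' t) (by
    rw [h0, h1, e3, e4, abs_of_nonpos (by linarith [ht.2])]; ring)
  rwa [h0, e3] at this

/-- Two geodesics that leave a point in opposite directions together form a geodesic. -/
theorem IsCAT0.rdist_eq_add_of_opposite (h : IsCAT0 Y) {c : ℝ → Y} {L : ℝ} (hc : IsGeodesic c 0 L)
    {t : ℝ} (h0t : 0 < t) (htL : t ≤ L) {x : Y}
    (hx : rdist x (c t) = rdist x (c 0) + t) : rdist x (c L) = rdist x (c 0) + L := by
  have hL : 0 < L := h0t.trans_le htL
  have e1 : rdist (c 0) (c L) = L := hc.rdist_zero_eq ⟨hc.1, le_rfl⟩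
  refine le_antisymm ((h.rdist_triangle x (c 0) (c L)).trans_eq (by rw [e1])) ?_
  rcases (rdist_nonneg x (c 0)).eq_or_lt with hx0 | hx0
  · rw [h.eq_of_rdist_eq_zero hx0.symm, rdist_self, e1, zero_add]
  obtain ⟨c', hc', h1, h2⟩ := h.exists_isGeodesic (c 0) x
  rw [rdist_comm] at hx0
  have key := h.comparison_sq hL hx0 hc hc' h1.symm (s := t) (t := rdist (c 0) x) ⟨h0t.le, htL⟩
    ⟨hx0.le, le_rfl⟩
  rw [h2, rdist_comm (c t), hx, rdist_comm x (c 0), rdist_comm (c L) x] at key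
  rw [rdist_comm x (c 0)]
  set M := rdist (c 0) x
  have h3 : t * M * ((M + L) ^ 2 - rdist x (c L) ^ 2) ≤ 0 := by nlinarith
  have h4 := nonpos_of_mul_nonpos_right h3 (mul_pos h0t hx0)
  exact le_of_sq_le_sq (by linarith) (rdist_nonneg _ _)

/-- On two geodesics issuing from a common point, the points at the same proportion `μ` of the way
are at most as far apart as the endpoints. -/
theorem IsCAT0.rdist_proportional_le (h : IsCAT0 Y) {c c' : ℝ → Y} {L L' : ℝ} (hL : 0 < L)
    (hL' : 0 < L') (hc : IsGeodesic c 0 L) (hc' : IsGeodesic c' 0 L') (h0 : c 0 = c' 0) {μ : ℝ}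
    (hμ : μ ∈ Icc (0 : ℝ) 1) : rdist (c (μ * L)) (c' (μ * L')) ≤ rdist (c L) (c' L') := by
  have key := h.comparison_sq hL hL' hc hc' h0 (s := μ * L) (t := μ * L')
    ⟨mul_nonneg hμ.1 hL.le, mul_le_of_le_one_left hL.le hμ.2⟩
    ⟨mul_nonneg hμ.1 hL'.le, mul_le_of_le_one_left hL'.le hμ.2⟩
  have h1 : L * L' * rdist (c (μ * L)) (c' (μ * L')) ^ 2 ≤
      L * L' * (μ * rdist (c L) (c' L')) ^ 2 := key.trans_eq (by ring)
  have h2 := le_of_mul_le_mul_left h1 (mul_pos hL hL')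
  have h3 := le_of_sq_le_sq h2 (mul_nonneg hμ.1 (rdist_nonneg _ _))
  exact h3.trans (mul_le_of_le_one_left (rdist_nonneg _ _) hμ.2)

end CAT0

namespace EuclideanTriangleComplex

variable {V : Type*} {X : EuclideanTriangleComplex V}

/-! ### Developing the star of an edge into the plane -/

/-- The affine extension to the complex of a map `P` from the vertices to the plane. -/
def develop (P : V → ℂ) (x : X.Realization) : ℂ := x.coord.sum fun w a => a • P w

theorem sum_coord_eq_one (x : X.Realization) {σ : Finset V} (hx : x.supp ⊆ σ) :
    ∑ w ∈ σ, x.coord w = 1 := by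
  rw [← x.sum_eq_one, Finsupp.sum_of_support_subset _ hx _ (fun _ _ => rfl)]

theorem develop_eq_sum (P : V → ℂ) (x : X.Realization) {σ : Finset V} (hx : x.supp ⊆ σ) :
    develop P x = ∑ w ∈ σ, x.coord w • P w :=
  Finsupp.sum_of_support_subset _ hx _ (fun _ _ => zero_smul _ _)

theorem coord_pos_of_mem (x : X.Realization) {w : V} (hw : w ∈ x.supp) : 0 < x.coord w :=
  (x.nonneg w).lt_of_ne' (Finsupp.mem_support_iff.1 hw)

theorem develop_vertexPoint (P : V → ℂ) (v : V) : develop P (X.vertexPoint v) = P v := by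
  simp [develop, vertexPoint]

/-- If `P` realizes the edge lengths of a simplex, then its affine extension is isometric there. -/
theorem simplexDist_eq_dist_develop {P : V → ℂ} {σ : Finset V}
    (hP : ∀ i ∈ σ, ∀ j ∈ σ, ‖P i - P j‖ = X.len i j) {x y : X.Realization} (hx : x.supp ⊆ σ)
    (hy : y.supp ⊆ σ) : simplexDist x y = dist (develop P x) (develop P y) := by
  classical
  have hsub : (x.coord - y.coord).support ⊆ σ :=
    Finsupp.support_sub.trans (Finset.union_subset hx hy)
  have h0 : ∑ w ∈ σ, (x.coord - y.coord) w = 0 := by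
    simp [sum_coord_eq_one x hx, sum_coord_eq_one y hy]
  have hd : develop P x - develop P y = ∑ w ∈ σ, (x.coord - y.coord) w • P w := by
    rw [develop_eq_sum P x hx, develop_eq_sum P y hy, ← Finset.sum_sub_distrib]
    simp [sub_smul]
  rw [dist_eq_norm, hd, ← Real.sqrt_sq (norm_nonneg _), ← real_inner_self_eq_norm_sq,
    inner_sum_smul_sum_smul_of_sum_eq_zero P h0 P h0, simplexDist,
    Finsupp.sum_of_support_subset _ hsub _ (by simp)]
  congr 1
  rw [neg_div, Finset.sum_div, neg_mul, Finset.mul_sum]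
  refine congrArg _ (Finset.sum_congr rfl fun i hi => ?_)
  rw [Finsupp.sum_of_support_subset _ hsub _ (by simp), Finset.sum_div, Finset.mul_sum]
  refine Finset.sum_congr rfl fun j hj => ?_
  rw [hP i hi j hj]
  ring

/-- The foot on the line `uv` of the perpendicular from the apex of a triangle whose edges at the
apex have lengths `a` (to `u`) and `b` (to `v`), where `l` is the length of `uv`. -/
def foot (l a b : ℝ) : ℝ := (l ^ 2 + a ^ 2 - b ^ 2) / (2 * l)

/-- The height of such a triangle. -/
def height (l a b : ℝ) : ℝ := √(a ^ 2 - foot l a b ^ 2)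

theorem sq_sub_foot_sq_pos {l a b : ℝ} (hl : 0 < l) (h1 : l < a + b) (h2 : a < l + b)
    (h3 : b < l + a) : 0 < a ^ 2 - foot l a b ^ 2 := by
  have e1 : a - foot l a b = (b - a + l) * (b + a - l) / (2 * l) := by
    unfold foot; field_simp; ring
  have e2 : a + foot l a b = (l + a - b) * (l + a + b) / (2 * l) := by
    unfold foot; field_simp; ring
  have p1 : 0 < a - foot l a b := by
    rw [e1]; exact div_pos (mul_pos (by linarith) (by linarith)) (by linarith)
  have p2 : 0 < a + foot l a b := by
    rw [e2]; exact div_pos (mul_pos (by linarith) (by linarith)) (by linarith)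
  nlinarith

theorem height_pos {l a b : ℝ} (hl : 0 < l) (h1 : l < a + b) (h2 : a < l + b) (h3 : b < l + a) :
    0 < height l a b := Real.sqrt_pos.2 (sq_sub_foot_sq_pos hl h1 h2 h3)

theorem foot_sub_sq {l a b : ℝ} (hl : 0 < l) :
    (foot l a b - l) ^ 2 = foot l a b ^ 2 + b ^ 2 - a ^ 2 := by
  unfold foot; field_simp; ring

variable (X) in
open Classical in
/-- The position in the plane of a vertex `w`, when the edge `uv` is placed on the real axis: the
apex of `T` goes to the upper half plane, the apices of the other triangles at `uv` are all
folded into the lower half plane. -/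
def vertexPosition (u v : V) (T : Finset V) (w : V) : ℂ :=
  ⟨foot (X.len u v) (X.len u w) (X.len v w),
    if w ∈ T then height (X.len u v) (X.len u w) (X.len v w)
      else -height (X.len u v) (X.len u w) (X.len v w)⟩

variable [DecidableEq V] {u v : V}

theorem edge_len_pos (huv : u ≠ v) (he : {u, v} ∈ X.faces) : 0 < X.len u v :=
  X.len_pos _ he u (by simp) v (by simp) huv

theorem vertexPosition_left (huv : u ≠ v) (he : {u, v} ∈ X.faces) (T : Finset V) :
    vertexPosition X u v T u = 0 := by
  have hl := (edge_len_pos huv he).ne'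
  have h1 : foot (X.len u v) 0 (X.len v u) = 0 := by simp [foot, X.len_symm v u]
  apply Complex.ext <;> simp [vertexPosition, h1, height, X.len_self]

theorem vertexPosition_right (huv : u ≠ v) (he : {u, v} ∈ X.faces) (T : Finset V) :
    vertexPosition X u v T v = (X.len u v : ℂ) := by
  have hl := (edge_len_pos huv he).ne'
  have h1 : foot (X.len u v) (X.len u v) 0 = X.len u v := by
    simp only [foot]; field_simp; ring
  apply Complex.ext <;> simp [vertexPosition, h1, height, X.len_self]

theorem apex_ineq (huv : u ≠ v) {w : V} (hwu : w ≠ u) (hwv : w ≠ v) {σ : Finset V}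
    (hσ : σ ∈ X.faces) (he : {u, v} ⊆ σ) (hw : w ∈ σ) :
    X.len u v < X.len u w + X.len v w ∧ X.len u w < X.len u v + X.len v w ∧
      X.len v w < X.len u v + X.len u w := by
  have hu : u ∈ σ := he (by simp)
  have hv : v ∈ σ := he (by simp)
  have h1 := X.len_triangle σ hσ u hu w hw v hv hwu.symm hwv huv
  have h2 := X.len_triangle σ hσ u hu v hv w hw huv hwv.symm hwu.symm
  have h3 := X.len_triangle σ hσ v hv u hu w hw huv.symm hwu.symm hwv.symm
  rw [X.len_symm w v] at h1
  rw [X.len_symm v u] at h3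
  exact ⟨h1, h2, h3⟩

theorem edge_face_of_subset {σ : Finset V} (hσ : σ ∈ X.faces) (he : {u, v} ⊆ σ) :
    {u, v} ∈ X.faces := (X.isRelLowerSet_faces hσ).2 he (by simp)

/-- A simplex containing the edge `uv` has at most one further vertex. -/
theorem eq_of_mem_of_mem (huv : u ≠ v) {σ : Finset V} (hσ : σ ∈ X.faces) (he : {u, v} ⊆ σ) {i j : V}
    (hi : i ∈ σ) (hj : j ∈ σ) (hiu : i ≠ u) (hiv : i ≠ v) (hju : j ≠ u) (hjv : j ≠ v) : i = j := by
  by_contra hij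
  have h1 : ({i, j, u, v} : Finset V) ⊆ σ := by
    intro x hx
    simp only [Finset.mem_insert, Finset.mem_singleton] at hx
    rcases hx with rfl | rfl | rfl | rfl
    exacts [hi, hj, he (by simp), he (by simp)]
  have h2 := Finset.card_le_card h1
  rw [Finset.card_insert_of_notMem (by simp [hij, hiu, hiv]),
    Finset.card_insert_of_notMem (by simp [hju, hjv]), Finset.card_pair huv] at h2
  have := X.card_le_three σ hσ
  omega

theorem eq_or_eq_insert (huv : u ≠ v) {σ : Finset V} (hσ : σ ∈ X.faces) (he : {u, v} ⊆ σ) :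
    σ = {u, v} ∨ ∃ w, w ≠ u ∧ w ≠ v ∧ σ = {w, u, v} := by
  by_cases h : σ ⊆ {u, v}
  · exact Or.inl (h.antisymm he)
  · obtain ⟨w, hw, hwe⟩ := Finset.not_subset.1 h
    simp only [Finset.mem_insert, Finset.mem_singleton, not_or] at hwe
    refine Or.inr ⟨w, hwe.1, hwe.2, Finset.Subset.antisymm (fun i hi => ?_) ?_⟩
    · by_cases hiu : i = u
      · simp [hiu]
      by_cases hiv : i = v
      · simp [hiv]
      simp [eq_of_mem_of_mem huv hσ he hi hw hiu hiv hwe.1 hwe.2]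
    · intro i hi
      rcases Finset.mem_insert.1 hi with rfl | hi
      exacts [hw, he hi]

theorem norm_vertexPosition_sub (huv : u ≠ v) (T : Finset V) {σ : Finset V} (hσ : σ ∈ X.faces)
    (he : {u, v} ⊆ σ) {i j : V} (hi : i ∈ σ) (hj : j ∈ σ) :
    ‖vertexPosition X u v T i - vertexPosition X u v T j‖ = X.len i j := by
  have hf := edge_face_of_subset hσ he
  have hl := edge_len_pos huv hf
  have e : ∀ i, i ≠ u → i ≠ v → i ∈ σ →
      ‖vertexPosition X u v T i - vertexPosition X u v T u‖ = X.len u i ∧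
      ‖vertexPosition X u v T i - vertexPosition X u v T v‖ = X.len v i := by
    intro i hiu hiv hi
    obtain ⟨h1, h2, h3⟩ := apex_ineq huv hiu hiv hσ he hi
    have hsq : (vertexPosition X u v T i).im ^ 2 =
        X.len u i ^ 2 - foot (X.len u v) (X.len u i) (X.len v i) ^ 2 := by
      have := Real.sq_sqrt (sq_sub_foot_sq_pos hl h1 h2 h3).le
      unfold vertexPosition height
      split_ifs <;> simp [this]
    have hre : (vertexPosition X u v T i).re = foot (X.len u v) (X.len u i) (X.len v i) := rfl
    have p1 : 0 ≤ X.len u i := by linarith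
    have p2 : 0 ≤ X.len v i := by linarith
    rw [vertexPosition_left huv hf, vertexPosition_right huv hf, sub_zero]
    constructor
    · rw [← Real.sqrt_sq p1, ← Real.sqrt_sq (norm_nonneg _), Complex.sq_norm,
        Complex.normSq_apply, ← sq, ← sq, hsq, hre]
      congr 1; ring
    · rw [← Real.sqrt_sq p2, ← Real.sqrt_sq (norm_nonneg _), Complex.sq_norm,
        Complex.normSq_apply, ← sq, ← sq]
      simp only [Complex.sub_re, Complex.sub_im, Complex.ofReal_re, Complex.ofReal_im, sub_zero]
      rw [hsq, hre, foot_sub_sq hl]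
      congr 1; ring
  have e0 : ‖vertexPosition X u v T u - vertexPosition X u v T v‖ = X.len u v := by
    rw [vertexPosition_left huv hf, vertexPosition_right huv hf, zero_sub, norm_neg,
      Complex.norm_real, Real.norm_eq_abs, abs_of_pos hl]
  by_cases hij : i = j
  · rw [hij, sub_self, norm_zero, X.len_self]
  by_cases hiu : i = u
  · subst hiu
    by_cases hjv : j = v
    · subst hjv; exact e0
    · rw [norm_sub_rev]; exact (e j (Ne.symm hij) hjv hj).1
  by_cases hiv : i = v
  · subst hiv
    by_cases hju : j = u
    · subst hju; rw [norm_sub_rev, e0, X.len_symm]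
    · rw [norm_sub_rev]; exact (e j hju (Ne.symm hij) hj).2
  by_cases hju : j = u
  · subst hju; rw [(e i hiu hiv hi).1, X.len_symm]
  by_cases hjv : j = v
  · subst hjv; rw [(e i hiu hiv hi).2, X.len_symm]
  exact absurd (eq_of_mem_of_mem huv hσ he hi hj hiu hiv hju hjv) hij

variable (X) in
/-- The chart of the star of the edge `uv`: it develops the triangle `T` into the upper half plane
and folds all other triangles at `uv` into the lower half plane. -/
def chart (u v : V) (T : Finset V) (x : X.Realization) : ℂ := develop (vertexPosition X u v T) x

theorem simplexDist_eq_dist_chart (huv : u ≠ v) (T : Finset V) {σ : Finset V} (hσ : σ ∈ X.faces)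
    (he : {u, v} ⊆ σ) {x y : X.Realization} (hx : x.supp ⊆ σ) (hy : y.supp ⊆ σ) :
    simplexDist x y = dist (chart X u v T x) (chart X u v T y) :=
  simplexDist_eq_dist_develop (fun _ hi _ hj => norm_vertexPosition_sub huv T hσ he hi hj) hx hy

theorem chart_of_supp_subset_pair (huv : u ≠ v) (he : {u, v} ∈ X.faces) (T : Finset V)
    {x : X.Realization} (hx : x.supp ⊆ {u, v}) :
    chart X u v T x = ((x.coord v * X.len u v : ℝ) : ℂ) := by
  rw [chart, develop_eq_sum _ x hx, Finset.sum_pair huv, vertexPosition_left huv he,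
    vertexPosition_right huv he]
  simp

theorem chart_of_supp_subset_triple (huv : u ≠ v) (he : {u, v} ∈ X.faces) (T : Finset V)
    {x : X.Realization} {w : V} (hwu : w ≠ u) (hwv : w ≠ v) (hx : x.supp ⊆ {w, u, v}) :
    chart X u v T x = x.coord w • vertexPosition X u v T w +
      ((x.coord v * X.len u v : ℝ) : ℂ) := by
  rw [chart, develop_eq_sum _ x hx, Finset.sum_insert (by simp [hwu, hwv]), Finset.sum_pair huv,
    vertexPosition_left huv he, vertexPosition_right huv he]
  simp

theorem chart_im_eq_zero (huv : u ≠ v) (he : {u, v} ∈ X.faces) (T : Finset V)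
    {x : X.Realization} (hx : x.supp ⊆ {u, v}) : (chart X u v T x).im = 0 := by
  rw [chart_of_supp_subset_pair huv he T hx, Complex.ofReal_im]

/-- The three positions of a point of the open star of `uv` with respect to the triangle `T`. -/
theorem chart_im_trichotomy (huv : u ≠ v) {T : Finset V} (hT : X.IsTriangle T) (heT : {u, v} ⊆ T)
    {x : X.Realization} (hx : {u, v} ⊆ x.supp) :
    x.supp = T ∧ 0 < (chart X u v T x).im ∨ x.supp = {u, v} ∧ (chart X u v T x).im = 0 ∨
      (x.supp ≠ T ∧ x.supp ≠ {u, v} ∧ (chart X u v T x).im < 0) := by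
  have hf := edge_face_of_subset hT.1 heT
  rcases eq_or_eq_insert huv x.support_mem hx with h | ⟨w, hwu, hwv, h⟩
  · exact Or.inr (Or.inl ⟨h, chart_im_eq_zero huv hf T (le_of_eq h)⟩)
  · replace h : x.supp = {w, u, v} := h
    have hw : w ∈ x.supp := by rw [h]; simp
    obtain ⟨h1, h2, h3⟩ := apex_ineq huv hwu hwv x.support_mem hx hw
    have hpos := mul_pos (coord_pos_of_mem x hw) (height_pos (edge_len_pos huv hf) h1 h2 h3)
    have him : (chart X u v T x).im = x.coord w * (vertexPosition X u v T w).im := by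
      rw [chart_of_supp_subset_triple huv hf T hwu hwv h.le]; simp
    rcases eq_or_eq_insert huv hT.1 heT with h' | ⟨w', hwu', hwv', h'⟩
    · have := hT.2
      rw [h', Finset.card_pair huv] at this
      omega
    by_cases hwT : w ∈ T
    · refine Or.inl ⟨?_, ?_⟩
      · have : w = w' := by simpa [h', hwu, hwv] using hwT
        rw [h, h', this]
      · rw [him, vertexPosition]
        simpa [hwT] using hpos
    · refine Or.inr (Or.inr ⟨fun h4 => hwT (h4 ▸ hw), fun h4 => ?_, ?_⟩)
      · rw [h4] at hw; simp [hwu, hwv] at hw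
      · rw [him, vertexPosition]
        simpa [hwT] using hpos

/-! ### The metric near an interior point of an edge -/

/-- In the triangle with vertices `0`, `l` and `p + q * I`, let `d` be the distance between the
point `t` of the side `[0, l]` and the point `xw * (p + q * I) + xv * l` of one of the other two
sides, whose length is `n`. Then `d` is at least the distance from `t` to the line through this
side, which is a height of the triangle times the barycentric coordinate of `t`. -/
theorem mul_le_dist_of_mem_side {l p q t xw xv d n : ℝ} (hn : 0 ≤ n) (hd : 0 ≤ d)
    (hdist : d ^ 2 = (xw * p + xv * l - t) ^ 2 + (xw * q) ^ 2)
    (h : xw + xv = 1 ∧ n ^ 2 = (p - l) ^ 2 + q ^ 2 ∨ xv = 0 ∧ n ^ 2 = p ^ 2 + q ^ 2) :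
    (|q| * (l - t) ≤ d * n) ∨ (|q| * t ≤ d * n) := by
  have hdn : 0 ≤ d * n := mul_nonneg hd hn
  rcases h with ⟨h1, h2⟩ | ⟨h1, h2⟩
  · left
    refine le_of_sq_le_sq ?_ hdn
    rw [mul_pow, mul_pow, sq_abs, hdist, h2]
    obtain rfl : xv = 1 - xw := by linarith
    nlinarith [sq_nonneg ((xw * p + (1 - xw) * l - t) * (l - p) - (xw * q) * q)]
  · right
    refine le_of_sq_le_sq ?_ hdn
    rw [mul_pow, mul_pow, sq_abs, hdist, h2, h1]
    nlinarith [sq_nonneg ((xw * p - t) * p + (xw * q) * q)]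

theorem coord_eq_zero_of_not_subset {x : X.Realization} (hx : ¬ {u, v} ⊆ x.supp) :
    x.coord u = 0 ∨ x.coord v = 0 := by
  by_contra! h
  refine hx fun i hi => ?_
  simp only [Finset.mem_insert, Finset.mem_singleton] at hi
  rcases hi with rfl | rfl
  exacts [Finsupp.mem_support_iff.2 h.1, Finsupp.mem_support_iff.2 h.2]

/-- The distance in the plane from a point `z` of the edge `uv` to the boundary of a triangle at
`uv` is bounded below in terms of the shape of the triangle. -/
theorem le_dist_chart_of_not_subset (huv : u ≠ v) (T : Finset V) {σ : Finset V}
    (hσ : σ ∈ X.faces) (he : {u, v} ⊆ σ) {x z : X.Realization} (hz : z.supp = {u, v})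
    (hx : x.supp ⊆ σ) (hxe : ¬ {u, v} ⊆ x.supp) {r : ℝ}
    (h0 : r ≤ min (z.coord u) (z.coord v) * X.len u v)
    (h1 : ∀ w, σ = {w, u, v} → w ≠ u → w ≠ v →
      r * (X.len u w + X.len v w) ≤ min (z.coord u) (z.coord v) * X.len u v *
        height (X.len u v) (X.len u w) (X.len v w)) :
    r ≤ dist (chart X u v T z) (chart X u v T x) := by
  have hf := edge_face_of_subset hσ he
  have hl := edge_len_pos huv hf
  have hz1 := sum_coord_eq_one z hz.le
  rw [Finset.sum_pair huv] at hz1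
  have hzc := chart_of_supp_subset_pair huv hf T hz.le
  set m := min (z.coord u) (z.coord v) with hm
  have hmu : m ≤ z.coord u := min_le_left _ _
  have hmv : m ≤ z.coord v := min_le_right _ _
  have hx0 := coord_eq_zero_of_not_subset hxe
  rcases eq_or_eq_insert huv hσ he with h | ⟨w, hwu, hwv, h⟩
  · rw [h] at hx
    have hx1 := sum_coord_eq_one x hx
    rw [Finset.sum_pair huv] at hx1
    rw [hzc, chart_of_supp_subset_pair huv hf T hx, dist_eq_norm, ← Complex.ofReal_sub,
      Complex.norm_real, Real.norm_eq_abs]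
    refine h0.trans ?_
    rcases hx0 with hx0 | hx0
    · rw [show x.coord v = 1 by linarith]
      refine le_trans ?_ (neg_le_abs _)
      nlinarith
    · rw [hx0]
      refine le_trans ?_ (le_abs_self _)
      nlinarith
  · have hw : w ∈ σ := by rw [h]; simp
    obtain ⟨t1, t2, t3⟩ := apex_ineq huv hwu hwv hσ he hw
    have ha : 0 < X.len u w := by linarith
    have hb : 0 < X.len v w := by linarith
    have h1 := h1 w h hwu hwv
    have hx' := hx
    rw [h] at hx'
    have hx1 := sum_coord_eq_one x hx'
    rw [Finset.sum_insert (by simp [hwu, hwv]), Finset.sum_pair huv] at hx1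
    have hxc := chart_of_supp_subset_triple huv hf T hwu hwv hx'
    have na := norm_vertexPosition_sub huv T hσ he hw (he (by simp : u ∈ _))
    have nb := norm_vertexPosition_sub huv T hσ he hw (he (by simp : v ∈ _))
    rw [X.len_symm, vertexPosition_left huv hf, sub_zero] at na
    rw [X.len_symm, vertexPosition_right huv hf] at nb
    have hq : |(vertexPosition X u v T w).im| =
        height (X.len u v) (X.len u w) (X.len v w) := by
      have := (height_pos hl t1 t2 t3).le
      unfold vertexPosition
      split_ifs
      · exact abs_of_nonneg this
      · rw [abs_neg]; exact abs_of_nonneg this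
    set p := (vertexPosition X u v T w).re
    set q := (vertexPosition X u v T w).im
    have na2 : X.len u w ^ 2 = p ^ 2 + q ^ 2 := by
      rw [← na, Complex.sq_norm, Complex.normSq_apply]; ring
    have nb2 : X.len v w ^ 2 = (p - X.len u v) ^ 2 + q ^ 2 := by
      rw [← nb, Complex.sq_norm, Complex.normSq_apply]; simp [p, q]; ring
    set d := dist (chart X u v T z) (chart X u v T x) with hd
    have hdn : 0 ≤ d := dist_nonneg
    have hd2 : d ^ 2 = (x.coord w * p + x.coord v * X.len u v - z.coord v * X.len u v) ^ 2 +
        (x.coord w * q) ^ 2 := by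
      rw [hd, dist_comm, dist_eq_norm, Complex.sq_norm, Complex.normSq_apply, hxc, hzc]
      simp [p, q]; ring
    have hqn := abs_nonneg q
    rw [← hq] at h1
    have fin : ∀ n, 0 ≤ n → n ≤ X.len u w + X.len v w →
        (|q| * (X.len u v - z.coord v * X.len u v) ≤ d * n ∨
          |q| * (z.coord v * X.len u v) ≤ d * n) → r ≤ d := by
      intro n hn0 hn hcase
      refine le_of_mul_le_mul_right (h1.trans ?_) (add_pos ha hb)
      refine le_trans ?_ (mul_le_mul_of_nonneg_left hn hdn)
      have hlq : 0 ≤ X.len u v * |q| := mul_nonneg hl.le hqn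
      rcases hcase with hc | hc
      · refine le_trans ?_ hc
        rw [show z.coord v = 1 - z.coord u by linarith]
        nlinarith
      · refine le_trans ?_ hc
        nlinarith
    rcases hx0 with hx0 | hx0
    · exact fin _ hb.le (by linarith)
        (mul_le_dist_of_mem_side hb.le hdn hd2 (Or.inl ⟨by linarith, nb2⟩))
    · exact fin _ ha.le (by linarith)
        (mul_le_dist_of_mem_side ha.le hdn hd2 (Or.inr ⟨hx0, na2⟩))

/-- Since the triangles at the edge `uv` have finitely many shapes, the distance in the plane from
a point `z` of the interior of `uv` to the boundaries of these triangles is bounded below. -/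
theorem FiniteShapesInBalls.exists_radius (hfin : X.FiniteShapesInBalls) (huv : u ≠ v)
    {z : X.Realization} (hz : z.supp = {u, v}) :
    ∃ r > 0, ∀ (T σ : Finset V), σ ∈ X.faces → {u, v} ⊆ σ → ∀ x : X.Realization, x.supp ⊆ σ →
      ¬ {u, v} ⊆ x.supp → r ≤ dist (chart X u v T z) (chart X u v T x) := by
  have hf : {u, v} ∈ X.faces := hz ▸ z.support_mem
  have hl := edge_len_pos huv hf
  have hm : 0 < min (z.coord u) (z.coord v) * X.len u v :=
    mul_pos (lt_min (coord_pos_of_mem z (by rw [hz]; simp))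
      (coord_pos_of_mem z (by rw [hz]; simp))) hl
  obtain ⟨F, hF, hFs⟩ := hfin z 1
  -- all edge lengths of triangles at `uv` lie in the finite set `B`
  set A : Set V := ⋃ τ ∈ F, (τ : Set V) with hA
  have hAf : A.Finite := hF.biUnion fun τ _ => τ.finite_toSet
  set B : Set ℝ := image2 X.len A A with hB
  have hBf : B.Finite := hAf.image2 _ hAf
  have hmemB : ∀ σ ∈ X.faces, {u, v} ⊆ σ → ∀ i ∈ σ, ∀ j ∈ σ, X.len i j ∈ B := by
    intro σ hσ he i hi j hj
    obtain ⟨τ, hτF, -, f, hf⟩ := hFs σ hσ ⟨z, hz.le.trans he, by simp⟩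
    rw [← hf ⟨i, hi⟩ ⟨j, hj⟩]
    exact mem_image2_of_mem (mem_biUnion hτF (f _).2) (mem_biUnion hτF (f _).2)
  have hev : ∀ᶠ r in 𝓝[>] (0 : ℝ), ∀ ab ∈ B ×ˢ B, 0 < height (X.len u v) ab.1 ab.2 →
      r * (ab.1 + ab.2) ≤
        min (z.coord u) (z.coord v) * X.len u v * height (X.len u v) ab.1 ab.2 := by
    refine (eventually_all_finite (hBf.prod hBf)).2 fun ab _ => ?_
    by_cases hh : 0 < height (X.len u v) ab.1 ab.2
    · have hc : Tendsto (fun r : ℝ => r * (ab.1 + ab.2)) (𝓝[>] 0) (𝓝 (0 * (ab.1 + ab.2))) :=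
        ((continuous_id.mul continuous_const).tendsto 0).mono_left nhdsWithin_le_nhds
      rw [zero_mul] at hc
      filter_upwards [hc.eventually (eventually_lt_nhds (mul_pos hm hh))] with r hr _
      exact hr.le
    · exact Eventually.of_forall fun r h => absurd h hh
  have hev2 : ∀ᶠ r in 𝓝[>] (0 : ℝ), r ≤ min (z.coord u) (z.coord v) * X.len u v :=
    nhdsWithin_le_nhds ((eventually_lt_nhds hm).mono fun r hr => hr.le)
  obtain ⟨r, ⟨h1, h2⟩, hr⟩ := ((hev.and hev2).and self_mem_nhdsWithin).exists
  refine ⟨r, hr, fun T σ hσ he x hx hxe => le_dist_chart_of_not_subset huv T hσ he hz hx hxe h2 ?_⟩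
  rintro w rfl hwu hwv
  obtain ⟨t1, t2, t3⟩ := apex_ineq huv hwu hwv hσ he (by simp)
  exact h1 (X.len u w, X.len v w) ⟨hmemB _ hσ he _ (by simp) _ (by simp),
    hmemB _ hσ he _ (by simp) _ (by simp)⟩ (height_pos hl t1 t2 t3)

/-- A string that starts in the open star of `uv` either stays there, and then is at least as long
as its image in the plane, or it leaves the star, and then it reaches a distance `r` from `z`. -/
theorem string_dichotomy (huv : u ≠ v) {z : X.Realization} {r : ℝ} {T : Finset V}
    (hr : ∀ σ : Finset V, σ ∈ X.faces → {u, v} ⊆ σ → ∀ x : X.Realization, x.supp ⊆ σ →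
      ¬ {u, v} ⊆ x.supp → r ≤ dist (chart X u v T z) (chart X u v T x))
    {p : ℕ → X.Realization} (h0 : {u, v} ⊆ (p 0).supp) (n : ℕ)
    (hp : ∀ i < n, ∃ σ ∈ X.faces, (p i).supp ⊆ σ ∧ (p (i + 1)).supp ⊆ σ) :
    ({u, v} ⊆ (p n).supp ∧
      ENNReal.ofReal (dist (chart X u v T (p 0)) (chart X u v T (p n))) ≤ stringLength n p) ∨
    ENNReal.ofReal (r - dist (chart X u v T z) (chart X u v T (p 0))) ≤ stringLength n p := by
  induction n with
  | zero => left; simpa using h0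
  | succ n ih =>
    have hs : stringLength (n + 1) p =
        stringLength n p + ENNReal.ofReal (simplexDist (p n) (p (n + 1))) := by
      unfold stringLength; rw [Finset.sum_range_succ]
    rcases ih (fun i hi => hp i (by omega)) with ⟨h1, h2⟩ | h
    · obtain ⟨σ, hσ, s1, s2⟩ := hp n (by omega)
      have hle : ENNReal.ofReal (dist (chart X u v T (p 0)) (chart X u v T (p (n + 1)))) ≤
          stringLength (n + 1) p := by
        rw [hs, simplexDist_eq_dist_chart huv T hσ (h1.trans s1) s1 s2]
        refine (ENNReal.ofReal_le_ofReal (dist_triangle _ (chart X u v T (p n)) _)).trans ?_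
        rw [ENNReal.ofReal_add dist_nonneg dist_nonneg]
        gcongr
      by_cases hin : {u, v} ⊆ (p (n + 1)).supp
      · exact Or.inl ⟨hin, hle⟩
      · right
        refine le_trans (ENNReal.ofReal_le_ofReal ?_) hle
        have := hr σ hσ (h1.trans s1) _ s2 hin
        linarith [dist_triangle (chart X u v T z) (chart X u v T (p 0)) (chart X u v T (p (n + 1)))]
    · right
      rw [hs]
      exact h.trans le_self_add

/-- A point `y` closer to `x` than the boundary of the star is in the open star, and the chart does
not increase the distance of `x` and `y`. -/
theorem mem_star_and_dist_chart_le (hcat : IsCAT0 X.Realization) (huv : u ≠ v)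
    {z : X.Realization} {r : ℝ} {T : Finset V}
    (hr : ∀ σ : Finset V, σ ∈ X.faces → {u, v} ⊆ σ → ∀ x : X.Realization, x.supp ⊆ σ →
      ¬ {u, v} ⊆ x.supp → r ≤ dist (chart X u v T z) (chart X u v T x))
    {x y : X.Realization} (hx : {u, v} ⊆ x.supp)
    (hxy : rdist x y < r - dist (chart X u v T z) (chart X u v T x)) :
    {u, v} ⊆ y.supp ∧ dist (chart X u v T x) (chart X u v T y) ≤ rdist x y := by
  have key : ∀ n p, IsString x y n p →
      ({u, v} ⊆ y.supp ∧
        ENNReal.ofReal (dist (chart X u v T x) (chart X u v T y)) ≤ stringLength n p) ∨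
      ENNReal.ofReal (r - dist (chart X u v T z) (chart X u v T x)) ≤ stringLength n p := by
    rintro n p ⟨rfl, rfl, hp⟩
    exact string_dichotomy huv hr hx n hp
  have hlt : glueDist x y < ENNReal.ofReal (r - dist (chart X u v T z) (chart X u v T x)) := by
    change edist x y < _
    rw [hcat.edist_eq]
    exact (ENNReal.ofReal_lt_ofReal_iff ((rdist_nonneg x y).trans_lt hxy)).2 hxy
  constructor
  · simp only [glueDist, iInf_lt_iff] at hlt
    obtain ⟨n, p, hp, hlt⟩ := hlt
    exact ((key n p hp).resolve_right (not_le.2 hlt)).1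
  · by_contra! hd
    have hlt2 : glueDist x y < ENNReal.ofReal (dist (chart X u v T x) (chart X u v T y)) := by
      change edist x y < _
      rw [hcat.edist_eq]
      exact (ENNReal.ofReal_lt_ofReal_iff ((rdist_nonneg x y).trans_lt hd)).2 hd
    replace hlt := lt_min hlt hlt2
    simp only [glueDist, iInf_lt_iff] at hlt
    obtain ⟨n, p, hp, hlt⟩ := hlt
    rcases key n p hp with h | h
    · exact absurd (hlt.trans_le (min_le_right _ _)) (not_lt.2 h.2)
    · exact absurd (hlt.trans_le (min_le_left _ _)) (not_lt.2 h)

omit [DecidableEq V] in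
theorem rdist_le_simplexDist (hcat : IsCAT0 X.Realization) {σ : Finset V} (hσ : σ ∈ X.faces)
    {x y : X.Realization} (hx : x.supp ⊆ σ) (hy : y.supp ⊆ σ) : rdist x y ≤ simplexDist x y := by
  have h0 : 0 ≤ simplexDist x y := Real.sqrt_nonneg _
  rw [← ENNReal.ofReal_le_ofReal_iff h0, ← hcat.edist_eq]
  refine (IsString.glueDist_le (n := 1) (p := fun i => if i = 0 then x else y)
    ⟨by simp, by simp, fun i hi => ?_⟩).trans (by simp [stringLength])
  obtain rfl : i = 0 := by omega
  exact ⟨σ, hσ, by simpa using hx, by simpa using hy⟩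

/-- The ball of radius `R` about `z` is contained in the open star of the edge `uv`, and there the
charts do not increase distances. -/
structure IsChartRadius (z : X.Realization) (u v : V) (R : ℝ) : Prop where
  pos : 0 < R
  subset_supp : ∀ x : X.Realization, rdist z x < R → {u, v} ⊆ x.supp
  dist_le : ∀ (T : Finset V) (x y : X.Realization), rdist z x < R → rdist z y < R →
    dist (chart X u v T x) (chart X u v T y) ≤ rdist x y

theorem exists_isChartRadius (hfin : X.FiniteShapesInBalls) (hcat : IsCAT0 X.Realization)
    (huv : u ≠ v) {z : X.Realization} (hz : z.supp = {u, v}) : ∃ R, IsChartRadius z u v R := by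
  obtain ⟨r, hr, h⟩ := hfin.exists_radius huv hz
  have hball : ∀ (T : Finset V) (x : X.Realization), rdist z x < r →
      {u, v} ⊆ x.supp ∧ dist (chart X u v T z) (chart X u v T x) ≤ rdist z x := fun T x hx =>
    mem_star_and_dist_chart_le hcat huv (h T) hz.ge (by rwa [dist_self, sub_zero])
  refine ⟨r / 3, by positivity, fun x hx => (hball ∅ x (by linarith)).1, fun T x y hx hy => ?_⟩
  obtain ⟨h1, h2⟩ := hball T x (by linarith)
  refine (mem_star_and_dist_chart_le hcat huv (h T) h1 ?_).2
  have := hcat.rdist_triangle x z y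
  rw [rdist_comm x z] at this
  linarith

theorem rdist_le_dist_chart (hcat : IsCAT0 X.Realization) (huv : u ≠ v) (T : Finset V)
    {x y : X.Realization} (hx : x.supp = {u, v}) (hy : {u, v} ⊆ y.supp) :
    rdist x y ≤ dist (chart X u v T x) (chart X u v T y) := by
  rw [← simplexDist_eq_dist_chart huv T y.support_mem hy (hx.le.trans hy) le_rfl]
  exact rdist_le_simplexDist hcat y.support_mem (hx.le.trans hy) le_rfl

namespace IsChartRadius

variable {z : X.Realization} {R : ℝ}

theorem mem_self (hR : IsChartRadius z u v R) : rdist z z < R := by rw [rdist_self]; exact hR.pos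

theorem dist_eq (hR : IsChartRadius z u v R) (hcat : IsCAT0 X.Realization) (huv : u ≠ v)
    (T : Finset V) {x y : X.Realization} (hx : x.supp = {u, v}) (hxR : rdist z x < R)
    (hyR : rdist z y < R) : dist (chart X u v T x) (chart X u v T y) = rdist x y :=
  (hR.dist_le T x y hxR hyR).antisymm (rdist_le_dist_chart hcat huv T hx (hR.subset_supp y hyR))

/-- Points metrically between a point `a` of the edge and a point `b` of the star are developed to
the straight segment between the images of `a` and `b`. -/
theorem wbtw_chart (hR : IsChartRadius z u v R) (hcat : IsCAT0 X.Realization) (huv : u ≠ v)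
    (T : Finset V) {a y b : X.Realization} (ha : a.supp = {u, v}) (haR : rdist z a < R)
    (hyR : rdist z y < R) (hbR : rdist z b < R) (h : rdist a y + rdist y b = rdist a b) :
    Wbtw ℝ (chart X u v T a) (chart X u v T y) (chart X u v T b) := by
  refine dist_add_dist_eq_iff.1 (le_antisymm ?_ (dist_triangle _ _ _))
  rw [hR.dist_eq hcat huv T ha haR hbR, ← h]
  exact add_le_add (hR.dist_le T a y haR hyR) (hR.dist_le T y b hyR hbR)

theorem supp_eq_of_between_edge (hR : IsChartRadius z u v R) (hcat : IsCAT0 X.Realization)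
    (huv : u ≠ v) {a y b : X.Realization} (ha : a.supp = {u, v}) (hb : b.supp = {u, v})
    (haR : rdist z a < R) (hyR : rdist z y < R) (hbR : rdist z b < R)
    (h : rdist a y + rdist y b = rdist a b) : y.supp = {u, v} := by
  have hf : {u, v} ∈ X.faces := ha ▸ a.support_mem
  have hy := hR.subset_supp y hyR
  by_contra hne
  have hT : X.IsTriangle y.supp := by
    refine ⟨y.support_mem, ?_⟩
    obtain ⟨w, hwu, hwv, h⟩ := (eq_or_eq_insert huv y.support_mem hy).resolve_left hne
    change y.supp = _ at h
    rw [h, Finset.card_insert_of_notMem (by simp [hwu, hwv]), Finset.card_pair huv]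
  obtain ⟨θ, -, hθ⟩ := hR.wbtw_chart hcat huv y.supp ha haR hyR hbR h
  have him := congrArg Complex.im hθ
  simp only [AffineMap.lineMap_apply, vsub_eq_sub, vadd_eq_add, Complex.add_im, Complex.smul_im,
    Complex.sub_im, chart_im_eq_zero huv hf _ ha.le, chart_im_eq_zero huv hf _ hb.le] at him
  rcases chart_im_trichotomy huv hT hy hy with h1 | h1 | h1
  · simp at him; linarith [h1.2]
  · exact hne h1.1
  · exact h1.1 rfl

theorem supp_eq_of_between_triangle (hR : IsChartRadius z u v R) (hcat : IsCAT0 X.Realization)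
    (huv : u ≠ v) {T : Finset V} (hT : X.IsTriangle T) {a y b : X.Realization}
    (ha : a.supp = {u, v}) (hb : b.supp = T) (haR : rdist z a < R) (hyR : rdist z y < R)
    (hbR : rdist z b < R) (h : rdist a y + rdist y b = rdist a b) (hay : 0 < rdist a y) :
    y.supp = T := by
  have hf : {u, v} ∈ X.faces := ha ▸ a.support_mem
  have heT : {u, v} ⊆ T := hb ▸ hR.subset_supp b hbR
  obtain ⟨θ, hθ01, hθ⟩ := hR.wbtw_chart hcat huv T ha haR hyR hbR h
  have hθ0 : 0 < θ := by
    refine hθ01.1.lt_of_ne' fun h0 => ?_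
    rw [h0, AffineMap.lineMap_apply_zero] at hθ
    have := hR.dist_eq hcat huv T ha haR hyR
    rw [hθ, dist_self] at this
    linarith
  have him := congrArg Complex.im hθ
  simp only [AffineMap.lineMap_apply, vsub_eq_sub, vadd_eq_add, Complex.add_im, Complex.smul_im,
    Complex.sub_im, chart_im_eq_zero huv hf _ ha.le, sub_zero, add_zero, smul_eq_mul] at him
  have hbim : 0 < (chart X u v T b).im := by
    rcases chart_im_trichotomy huv hT heT (hR.subset_supp b hbR) with h1 | h1 | h1
    · exact h1.2
    · have := hT.2
      rw [← hb, h1.1, Finset.card_pair huv] at this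
      omega
    · exact absurd hb h1.1
  have hyim := mul_pos hθ0 hbim
  rw [him] at hyim
  rcases chart_im_trichotomy huv hT heT (hR.subset_supp y hyR) with h1 | h1 | h1
  · exact h1.1
  · linarith [h1.2]
  · linarith [h1.2.2]

theorem startsIn_of_supp_eq (hR : IsChartRadius z u v R) (hcat : IsCAT0 X.Realization)
    (huv : u ≠ v) {T : Finset V} (hT : X.IsTriangle T) {c : ℝ → X.Realization} {L t₀ : ℝ}
    (hc : IsGeodesic c 0 L) (h0 : (c 0).supp = {u, v}) (ht₀ : 0 < t₀) (ht₀L : t₀ ≤ L)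
    (ht₀R : rdist z (c 0) + t₀ < R) (hct : (c t₀).supp = T) : StartsIn c 0 L T := by
  have hball : ∀ t, 0 ≤ t → t ≤ t₀ → rdist z (c t) < R := fun t h1 h2 =>
    (hcat.rdist_triangle z (c 0) (c t)).trans_lt
      (by rw [hc.rdist_zero_eq ⟨h1, h2.trans ht₀L⟩]; linarith)
  refine ⟨t₀, ht₀, by rwa [zero_add], fun t ht => ?_⟩
  rw [zero_add] at ht
  have htL : t ∈ Icc 0 L := ⟨ht.1.le, ht.2.le.trans ht₀L⟩
  refine hR.supp_eq_of_between_triangle hcat huv hT h0 hct (hball 0 le_rfl ht₀.le)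
    (hball t ht.1.le ht.2.le) (hball t₀ ht₀.le le_rfl) ?_ ?_
  · rw [hc.rdist_zero_eq htL, hc.rdist_zero_eq ⟨ht₀.le, ht₀L⟩, hc.rdist_eq htL ⟨ht₀.le, ht₀L⟩,
      abs_of_nonpos (by linarith [ht.2])]
    ring
  · rw [hc.rdist_zero_eq htL]; exact ht.1

end IsChartRadius

/-! ### Sliding along an edge -/

/-- The geodesic from `z` to `x₀` is nontrivial and starts in the simplex `T`. -/
def HeadsInto (x₀ z : X.Realization) (T : Finset V) : Prop :=
  ∃ (c : ℝ → X.Realization) (L : ℝ), 0 < L ∧ IsGeodesic c 0 L ∧ c 0 = z ∧ c L = x₀ ∧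
    StartsIn c 0 L T

omit [DecidableEq V] in
theorem StartsIn.eq {c c' : ℝ → X.Realization} {L : ℝ} {T T' : Finset V} (h : StartsIn c 0 L T)
    (h' : StartsIn c' 0 L T') (hcc' : ∀ t ∈ Icc 0 L, c t = c' t) : T = T' := by
  obtain ⟨ε, hε, hεL, h⟩ := h
  obtain ⟨ε', hε', -, h'⟩ := h'
  have hm := lt_min hε hε'
  have h1 := min_le_left ε ε'
  have h2 := min_le_right ε ε'
  rw [← h (min ε ε' / 2) ⟨by linarith, by linarith⟩,
    ← h' (min ε ε' / 2) ⟨by linarith, by linarith⟩, hcc' _ ⟨by linarith, by linarith⟩]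

omit [DecidableEq V] in
theorem HeadsInto.startsIn {x₀ z : X.Realization} {T : Finset V} (h : HeadsInto x₀ z T)
    (hcat : IsCAT0 X.Realization) {c : ℝ → X.Realization} {L : ℝ} (hc : IsGeodesic c 0 L)
    (h0 : c 0 = z) (hL : c L = x₀) : StartsIn c 0 L T := by
  obtain ⟨c', L', -, hc', h0', hL', ε, hε, hεL, hs⟩ := h
  obtain ⟨rfl, h2⟩ := hcat.geodesic_unique hc hc' (h0.trans h0'.symm) (hL.trans hL'.symm)
  exact ⟨ε, hε, hεL, fun t ht => by rw [h2 t ⟨ht.1.le, ht.2.le.trans hεL⟩, hs t ht]⟩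

omit [DecidableEq V] in
theorem HeadsInto.eq {x₀ z : X.Realization} {T T' : Finset V} (h : HeadsInto x₀ z T)
    (h' : HeadsInto x₀ z T') (hcat : IsCAT0 X.Realization) : T = T' := by
  obtain ⟨c, L, -, hc, h0, hL, hs⟩ := h
  exact hs.eq (h'.startsIn hcat hc h0 hL) fun _ _ => rfl

omit [DecidableEq V] in
theorem HeadsInto.ne {x₀ z : X.Realization} {T : Finset V} (h : HeadsInto x₀ z T) : x₀ ≠ z := by
  obtain ⟨c, L, hL, hc, h0, h1, -⟩ := h
  rintro rfl
  have := hc.rdist_zero_eq ⟨hL.le, le_rfl⟩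
  rw [h0, h1, rdist_self] at this
  exact hL.ne this

/-- A geodesic that passes through a further point `y` of the edge starts along the edge. -/
theorem IsChartRadius.not_headsInto {z : X.Realization} {R : ℝ} (hR : IsChartRadius z u v R)
    (hcat : IsCAT0 X.Realization) (huv : u ≠ v) {T : Finset V} (hT : X.IsTriangle T)
    {x₀ a y : X.Realization} (ha : a.supp = {u, v}) (hy : y.supp = {u, v}) (hay : 0 < rdist a y)
    (hRay : rdist z a + rdist a y < R) (h : rdist a y + rdist y x₀ = rdist a x₀) :
    ¬ HeadsInto x₀ a T := by
  rintro ⟨c, L, hL, hc, rfl, rfl, ε, hε, hεL, hs⟩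
  have h1 : rdist (c 0) (c L) = L := hc.rdist_zero_eq ⟨hL.le, le_rfl⟩
  have h2 := hcat.apply_rdist_eq hc (h.trans h1)
  set κ := rdist (c 0) y with hκ
  have hκL : κ ≤ L := by linarith [rdist_nonneg y (c L)]
  have hm := lt_min hε hay
  have m1 := min_le_left ε κ
  have m2 := min_le_right ε κ
  set t := min ε κ / 2 with ht
  have htL : t ∈ Icc 0 L := ⟨by linarith, by linarith⟩
  have d1 := hc.rdist_zero_eq htL
  have hsupp := hs t ⟨by linarith, by linarith⟩
  have hsupp' := hR.supp_eq_of_between_edge hcat huv ha hy (by linarith) (y := c t)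
    ((hcat.rdist_triangle z (c 0) (c t)).trans_lt (by linarith))
    ((hcat.rdist_triangle z (c 0) y).trans_lt hRay) (by
      rw [d1, ← h2, hc.rdist_eq htL ⟨hay.le, hκL⟩,
        hc.rdist_zero_eq ⟨hay.le, hκL⟩, abs_of_nonpos (by linarith)]
      ring)
  have := hT.2
  rw [← hsupp, hsupp', Finset.card_pair huv] at this
  omega

/-- If the geodesic from `z` to `x₀` starts along the edge, say through `y`, then so do the
geodesics from the points of the edge near `z`: such a point lies either between `z` and `y`, or on
the other side of `z`, and then the geodesic first goes back to `z`. -/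
theorem IsChartRadius.rdist_add_eq_of_edge {z : X.Realization} {R : ℝ}
    (hR : IsChartRadius z u v R) (hcat : IsCAT0 X.Realization) (huv : u ≠ v)
    (hz : z.supp = {u, v}) {c : ℝ → X.Realization} {L κ : ℝ} (hc : IsGeodesic c 0 L)
    (h0 : c 0 = z) (hκ : 0 < κ) (hκL : κ ≤ L) (hκR : κ < R) (hy : (c κ).supp = {u, v})
    {a : X.Realization} (ha : a.supp = {u, v}) (haκ : rdist z a < κ) :
    rdist a (c κ) + rdist (c κ) (c L) = rdist a (c L) := by
  have hf : {u, v} ∈ X.faces := hz ▸ z.support_mem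
  have zy : rdist z (c κ) = κ := h0 ▸ hc.rdist_zero_eq ⟨hκ.le, hκL⟩
  have zx : rdist z (c L) = L := h0 ▸ hc.rdist_zero_eq ⟨hκ.le.trans hκL, le_rfl⟩
  have yx : rdist (c κ) (c L) = L - κ := by
    rw [hc.rdist_eq ⟨hκ.le, hκL⟩ ⟨hκ.le.trans hκL, le_rfl⟩, abs_of_nonpos (by linarith)]; ring
  -- on the edge itself all charts agree, so the choice of `T = ∅` is immaterial
  have hre : ∀ x y : X.Realization, x.supp = {u, v} → y.supp = {u, v} → rdist z x < R →
      rdist z y < R → rdist x y = |(chart X u v ∅ x).re - (chart X u v ∅ y).re| := by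
    intro x y hx hy hxR hyR
    have i1 := chart_im_eq_zero huv hf ∅ hx.le
    have i2 := chart_im_eq_zero huv hf ∅ hy.le
    rw [← hR.dist_eq hcat huv ∅ hx hxR hyR, Complex.dist_of_im_eq (by rw [i1, i2]), Real.dist_eq]
  have ezy := hre z (c κ) hz hy hR.mem_self (by linarith)
  have eza := hre z a hz ha hR.mem_self (by linarith)
  have eay := hre a (c κ) ha hy (by linarith) (by linarith)
  have tri := hcat.rdist_triangle a (c κ) (c L)
  have tri2 := hcat.rdist_triangle z a (c L)
  have hcases : rdist a (c κ) = κ - rdist z a ∨ rdist a (c κ) = rdist z a + κ := by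
    rw [zy] at ezy
    rw [eay, eza]
    rw [eza] at haκ
    set p := (chart X u v ∅ z).re
    set q := (chart X u v ∅ a).re
    set s := (chart X u v ∅ (c κ)).re
    grind
  rcases hcases with h | h
  · linarith
  · have := hcat.rdist_eq_add_of_opposite hc hκ hκL (x := a)
      (by rw [h0, h, rdist_comm a z])
    rw [h0, rdist_comm a z] at this
    linarith

/-- If the geodesic from `z` to `x₀` starts in the triangle `T`, then so do the geodesics from the
points of the edge near `z`, by continuous dependence of geodesics on their endpoints. -/
theorem IsChartRadius.headsInto_of_near {z : X.Realization} {R : ℝ}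
    (hR : IsChartRadius z u v R) (hcat : IsCAT0 X.Realization) (huv : u ≠ v) {T : Finset V}
    (hT : X.IsTriangle T) {c : ℝ → X.Realization} {L κ : ℝ} (hc : IsGeodesic c 0 L) (h0 : c 0 = z)
    (hκ : 0 < κ) (hκL : κ < L) (hκR : κ < R / 2) (hy : (c κ).supp = T) :
    ∃ δ > 0, ∀ a : X.Realization, a.supp = {u, v} → rdist z a < δ → HeadsInto (c L) a T := by
  have zy : rdist z (c κ) = κ := h0 ▸ hc.rdist_zero_eq ⟨hκ.le, hκL.le⟩
  have zx : rdist z (c L) = L := h0 ▸ hc.rdist_zero_eq ⟨(hκ.trans hκL).le, le_rfl⟩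
  have hL : 0 < L := hκ.trans hκL
  have hRpos := hR.pos
  have hstar := hR.subset_supp (c κ) (by linarith)
  have heT : {u, v} ⊆ T := hy ▸ hstar
  have him : 0 < (chart X u v T (c κ)).im := by
    rcases chart_im_trichotomy huv hT heT hstar with h1 | h1 | h1
    · exact h1.2
    · have := hT.2
      rw [← hy, h1.1, Finset.card_pair huv] at this
      omega
    · exact absurd hy h1.1
  set η := (chart X u v T (c κ)).im
  refine ⟨min (min η L) (R / 8), lt_min (lt_min him hL) (by linarith), fun a ha haδ => ?_⟩
  rw [lt_min_iff, lt_min_iff] at haδ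
  obtain ⟨⟨haη, haL⟩, haR⟩ := haδ
  obtain ⟨c', hc', h0', h1'⟩ := hcat.exists_isGeodesic a (c L)
  set L' := rdist a (c L) with hL'
  have hL'pos : 0 < L' := by linarith [hcat.rdist_triangle z a (c L)]
  have r1 := hc.reverse
  have r2 := hc'.reverse
  rw [sub_zero] at r1 r2
  have hμ : (L - κ) / L ∈ Icc (0 : ℝ) 1 :=
    ⟨div_nonneg (by linarith) hL.le, (div_le_one hL).2 (by linarith)⟩
  have key := hcat.rdist_proportional_le hL hL'pos r1 r2 (by simp [h1']) hμ
  -- `c' t₀` divides `c'` in the same proportion as `c κ` divides `c`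
  set t₀ := κ * L' / L with ht₀
  have ht₀pos : 0 < t₀ := div_pos (mul_pos hκ hL'pos) hL
  have ht₀L : t₀ ≤ L' := by rw [ht₀, div_le_iff₀ hL]; nlinarith
  have e1 : L - (L - κ) / L * L = κ := by field_simp; ring
  have e2 : L' - (L - κ) / L * L' = t₀ := by rw [ht₀]; field_simp; ring
  rw [e1, e2, sub_self, sub_self, h0, h0'] at key
  have hat : rdist a (c' t₀) = t₀ := h0' ▸ hc'.rdist_zero_eq ⟨ht₀pos.le, ht₀L⟩
  have b1 := hcat.rdist_triangle z (c κ) (c' t₀)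
  have b2 := hcat.rdist_triangle a z (c' t₀)
  rw [rdist_comm a z] at b2
  have hyR : rdist z (c' t₀) < R := by linarith
  have hdist := hR.dist_le T (c κ) (c' t₀) (by linarith) hyR
  have hsupp : (c' t₀).supp = T := by
    have habs := (Complex.abs_im_le_norm (chart X u v T (c κ) - chart X u v T (c' t₀)))
    rw [← dist_eq_norm, Complex.sub_im] at habs
    have hpos : 0 < (chart X u v T (c' t₀)).im := by
      have := le_abs_self ((chart X u v T (c κ)).im - (chart X u v T (c' t₀)).im)
      linarith
    rcases chart_im_trichotomy huv hT heT (hR.subset_supp _ hyR) with h1 | h1 | h1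
    · exact h1.1
    · linarith [h1.2]
    · linarith [h1.2.2]
  exact ⟨c', L', hL'pos, hc', h0', h1', hR.startsIn_of_supp_eq hcat huv hT hc' (by rw [h0', ha])
    ht₀pos ht₀L (by rw [h0']; linarith) hsupp⟩

/-- The side on which the geodesic to `x₀` leaves an edge is locally constant along the edge. -/
theorem exists_forall_headsInto_iff (hfin : X.FiniteShapesInBalls) (hcat : IsCAT0 X.Realization)
    (huv : u ≠ v) {z : X.Realization} (hz : z.supp = {u, v}) (x₀ : X.Realization) {T : Finset V}
    (hT : X.IsTriangle T) :
    ∃ δ > 0, ∀ a : X.Realization, a.supp = {u, v} → rdist z a < δ →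
      (HeadsInto x₀ a T ↔ HeadsInto x₀ z T) := by
  obtain ⟨R, hR⟩ := exists_isChartRadius hfin hcat huv hz
  have hRpos := hR.pos
  -- it is enough that the answer is the same at all points near `z`
  suffices h : ∃ δ > 0, (∀ a : X.Realization, a.supp = {u, v} → rdist z a < δ →
      HeadsInto x₀ a T) ∨ ∀ a : X.Realization, a.supp = {u, v} → rdist z a < δ →
      ¬ HeadsInto x₀ a T by
    obtain ⟨δ, hδ, h⟩ := h
    have hz0 : rdist z z < δ := by rwa [rdist_self]
    refine ⟨δ, hδ, fun a ha haδ => ?_⟩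
    rcases h with h | h
    · exact iff_of_true (h a ha haδ) (h z hz hz0)
    · exact iff_of_false (h a ha haδ) (h z hz hz0)
  by_cases hzx : z = x₀
  · refine ⟨R / 2, by positivity, Or.inr fun a ha haδ h => ?_⟩
    have hax := hcat.rdist_pos h.ne.symm
    subst hzx
    refine hR.not_headsInto hcat huv hT ha hz hax ?_ (by rw [rdist_self, add_zero]) h
    rw [rdist_comm a z]; linarith
  obtain ⟨c, hc, h0, h1⟩ := hcat.exists_isGeodesic z x₀
  have hLpos := hcat.rdist_pos hzx
  set L := rdist z x₀
  have hm := lt_min hLpos hRpos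
  have m1 := min_le_left L R
  have m2 := min_le_right L R
  -- the simplex that contains `c κ` in its interior tells how the geodesic from `z` starts
  set κ := min L R / 3 with hκ
  have zy : rdist z (c κ) = κ := h0 ▸ hc.rdist_zero_eq ⟨by linarith, by linarith⟩
  have hstar := hR.subset_supp (c κ) (by linarith)
  rcases eq_or_eq_insert huv (c κ).support_mem hstar with hy | ⟨w, hwu, hwv, hy⟩
  · refine ⟨κ, by linarith, Or.inr fun a ha haδ => ?_⟩
    have key := hR.rdist_add_eq_of_edge hcat huv hz hc h0 (by linarith) (by linarith)
      (by linarith) hy ha haδ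
    rw [h1] at key
    have tr := hcat.rdist_triangle z a (c κ)
    have tr2 := hcat.rdist_triangle a z (c κ)
    rw [rdist_comm a z] at tr2
    exact hR.not_headsInto hcat huv hT ha hy (by linarith) (by linarith) key
  · have hT' : X.IsTriangle (c κ).supp := ⟨(c κ).support_mem, by
      change (c κ).supp = _ at hy
      rw [hy, Finset.card_insert_of_notMem (by simp [hwu, hwv]), Finset.card_pair huv]⟩
    obtain ⟨δ, hδ, h⟩ := hR.headsInto_of_near hcat huv hT' hc h0 (by linarith)
      (by linarith : κ < L) (by linarith) rfl
    rw [h1] at h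
    by_cases hTT : T = (c κ).supp
    · exact ⟨δ, hδ, Or.inl fun a ha haδ => hTT ▸ h a ha haδ⟩
    · exact ⟨δ, hδ, Or.inr fun a ha haδ h' => hTT (h'.eq (h a ha haδ) hcat)⟩

/-- The side on which the geodesic to `x₀` leaves an edge does not change along a segment of the
edge. -/
theorem HeadsInto.slide (hfin : X.FiniteShapesInBalls) (hcat : IsCAT0 X.Realization)
    (huv : u ≠ v) {x₀ : X.Realization} {T : Finset V} (hT : X.IsTriangle T)
    {γ : ℝ → X.Realization} {a b : ℝ} (hγ : IsGeodesic γ a b)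
    (hs : ∀ s ∈ Icc a b, (γ s).supp = {u, v}) (h : HeadsInto x₀ (γ a) T) :
    HeadsInto x₀ (γ b) T := by
  have hlc : IsLocallyConstant fun s : Icc a b => HeadsInto x₀ (γ s) T := by
    refine (IsLocallyConstant.iff_eventually_eq _).2 fun s => ?_
    obtain ⟨δ, hδ, hloc⟩ := exists_forall_headsInto_iff hfin hcat huv (hs s s.2) x₀ hT
    filter_upwards [Metric.ball_mem_nhds s hδ] with t ht
    refine propext (hloc _ (hs t t.2) ?_)
    rw [hγ.rdist_eq s.2 t.2, abs_sub_comm]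
    exact ht
  have := isPreconnected_iff_preconnectedSpace.1 (isPreconnected_Icc (a := a) (b := b))
  have heq := hlc.apply_eq_of_preconnectedSpace ⟨a, le_rfl, hγ.1⟩ ⟨b, hγ.1, le_rfl⟩
  exact heq ▸ h

/-! ### Leaving an edge perpendicularly -/

omit [DecidableEq V] in
theorem StartsPerpendicularly.shift {γ : ℝ → X.Realization} {a b : ℝ} {e T : Finset V}
    (h : StartsPerpendicularly γ a b e T) :
    StartsPerpendicularly (fun s => γ (a + s)) 0 (b - a) e T := by
  obtain ⟨h1, h2, h3, ⟨ε, hε, hεb, h4⟩, h5⟩ := h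
  refine ⟨by simpa using h1, h2, h3, ⟨ε, hε, by linarith, fun t ht => h4 _
    ⟨by linarith [ht.1], by linarith [ht.2]⟩⟩, fun v hv => ?_⟩
  have ht : Tendsto (fun s : ℝ => a + s) (𝓝[>] 0) (𝓝[>] a) := by
    refine tendsto_nhdsWithin_iff.2 ⟨?_, ?_⟩
    · have := (continuous_const_add a).tendsto 0
      rw [add_zero] at this
      exact this.mono_left nhdsWithin_le_nhds
    · filter_upwards [self_mem_nhdsWithin] with s hs
      exact lt_add_of_pos_right a hs
  simpa [Function.comp_def] using (h5 v hv).comp ht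

omit [DecidableEq V] in
theorem EndsPerpendicularly.reverse {γ : ℝ → X.Realization} {a b : ℝ} {e T : Finset V}
    (h : EndsPerpendicularly γ a b e T) :
    StartsPerpendicularly (fun s => γ (b - s)) 0 (b - a) e T := by
  obtain ⟨h1, h2, h3, ⟨ε, hε, hεb, h4⟩, h5⟩ := h
  refine ⟨by simpa using h1, h2, h3, ⟨ε, hε, by linarith, fun t ht => h4 _
    ⟨by linarith [ht.2], by linarith [ht.1]⟩⟩, fun v hv => ?_⟩
  have ht : Tendsto (fun s : ℝ => b - s) (𝓝[>] 0) (𝓝[<] b) := by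
    refine tendsto_nhdsWithin_iff.2 ⟨?_, ?_⟩
    · have := (continuous_sub_left b).tendsto 0
      rw [sub_zero] at this
      exact this.mono_left nhdsWithin_le_nhds
    · filter_upwards [self_mem_nhdsWithin] with s hs
      exact sub_lt_self b hs
  simpa [Function.comp_def] using (h5 v hv).comp ht

/-- In the chart, the angle with the direction of `v` is the angle with the positive real axis. -/
theorem cos_simplexAngle (huv : u ≠ v) {T : Finset V} (hT : X.IsTriangle T) (heT : {u, v} ⊆ T)
    {z x : X.Realization} (hz : z.supp = {u, v}) (hx : x.supp = T)
    (hne : 0 < dist (chart X u v T z) (chart X u v T x)) :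
    Real.cos (simplexAngle z x (X.vertexPoint v)) =
      ((chart X u v T x).re - (chart X u v T z).re) /
        dist (chart X u v T z) (chart X u v T x) := by
  have hf := edge_face_of_subset hT.1 heT
  have hl := edge_len_pos huv hf
  have hv : (X.vertexPoint v).supp ⊆ T := fun i hi => by
    have : i = v := by
      by_contra h
      exact (Finsupp.mem_support_iff.1 hi) (Finsupp.single_eq_of_ne h)
    exact this ▸ heT (by simp)
  have hzT : z.supp ⊆ T := hz.le.trans heT
  have hz1 := sum_coord_eq_one z hz.le
  rw [Finset.sum_pair huv] at hz1
  have hzu := coord_pos_of_mem z (w := u) (by rw [hz]; simp)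
  have hzc := chart_of_supp_subset_pair huv hf T hz.le
  have hvc : chart X u v T (X.vertexPoint v) = (X.len u v : ℂ) := by
    rw [chart, develop_vertexPoint, vertexPosition_right huv hf]
  rw [simplexAngle, simplexDist_eq_dist_chart huv T hT.1 heT hzT hx.le,
    simplexDist_eq_dist_chart huv T hT.1 heT hzT hv,
    simplexDist_eq_dist_chart huv T hT.1 heT hx.le hv]
  have hD : dist (chart X u v T z) (chart X u v T (X.vertexPoint v)) =
      X.len u v * z.coord u := by
    rw [hzc, hvc, dist_eq_norm, ← Complex.ofReal_sub, Complex.norm_real, Real.norm_eq_abs,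
      show z.coord v * X.len u v - X.len u v = -(X.len u v * z.coord u) by
        rw [show z.coord v = 1 - z.coord u by linarith]; ring, abs_neg, abs_of_pos (by positivity)]
  have hDpos : 0 < X.len u v * z.coord u := by positivity
  have hsq1 : dist (chart X u v T z) (chart X u v T x) ^ 2 =
      ((chart X u v T x).re - (chart X u v T z).re) ^ 2 + (chart X u v T x).im ^ 2 := by
    rw [dist_comm, dist_eq_norm, Complex.sq_norm, Complex.normSq_apply, Complex.sub_re,
      Complex.sub_im, chart_im_eq_zero huv hf T hz.le]
    ring
  have hsq2 : dist (chart X u v T x) (chart X u v T (X.vertexPoint v)) ^ 2 =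
      ((chart X u v T x).re - X.len u v) ^ 2 + (chart X u v T x).im ^ 2 := by
    rw [dist_eq_norm, Complex.sq_norm, Complex.normSq_apply, hvc, Complex.sub_re,
      Complex.sub_im, Complex.ofReal_re, Complex.ofReal_im]
    ring
  have hzre : (chart X u v T z).re = z.coord v * X.len u v := by rw [hzc, Complex.ofReal_re]
  have hq : (dist (chart X u v T z) (chart X u v T x) ^ 2 +
      dist (chart X u v T z) (chart X u v T (X.vertexPoint v)) ^ 2 -
      dist (chart X u v T x) (chart X u v T (X.vertexPoint v)) ^ 2) /
      (2 * dist (chart X u v T z) (chart X u v T x) *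
        dist (chart X u v T z) (chart X u v T (X.vertexPoint v))) =
      ((chart X u v T x).re - (chart X u v T z).re) /
        dist (chart X u v T z) (chart X u v T x) := by
    rw [div_eq_div_iff (by rw [hD]; positivity) hne.ne', hsq2, hsq1, hD, hzre,
      show z.coord v = 1 - z.coord u by linarith]
    ring
  have habs : |((chart X u v T x).re - (chart X u v T z).re) /
        dist (chart X u v T z) (chart X u v T x)| ≤ 1 := by
    rw [abs_div, abs_of_pos hne, div_le_one hne, dist_comm, dist_eq_norm, ← Complex.sub_re]
    exact Complex.abs_re_le_norm _
  rw [hq, Real.cos_arccos (abs_le.1 habs).1 (abs_le.1 habs).2]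

/-- The first variation inequality: if `c` leaves an edge perpendicularly into the triangle `T` and
`c'` does not start in `T`, then the angle between `c` and `c'` is at least `π / 2`, so that the
side opposite to it is at least as long as in a right-angled Euclidean triangle. -/
theorem StartsPerpendicularly.sq_add_sq_le (hfin : X.FiniteShapesInBalls)
    (hcat : IsCAT0 X.Realization) (huv : u ≠ v) {T : Finset V} {c c' : ℝ → X.Realization}
    {L L' : ℝ} (hL' : 0 < L') (hc : IsGeodesic c 0 L) (hc' : IsGeodesic c' 0 L')
    (h0 : c 0 = c' 0) (hperp : StartsPerpendicularly c 0 L {u, v} T)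
    (hnot : ¬ StartsIn c' 0 L' T) : L ^ 2 + L' ^ 2 ≤ rdist (c L) (c' L') ^ 2 := by
  obtain ⟨hz, hT, heT, ⟨ε, hε, hεL, hs⟩, hang⟩ := hperp
  rw [zero_add] at hεL hs
  have hL : 0 < L := hε.trans_le hεL
  have hf := edge_face_of_subset hT.1 heT
  obtain ⟨R, hR⟩ := exists_isChartRadius hfin hcat huv hz
  have hRpos := hR.pos
  have hm := lt_min hL' hRpos
  have m1 := min_le_left L' R
  have m2 := min_le_right L' R
  set κ := min L' R / 2 with hκ
  have hκ0 : 0 < κ := by linarith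
  have hκL : κ ∈ Icc 0 L' := ⟨hκ0.le, by linarith⟩
  have hyκ : rdist (c 0) (c' κ) = κ := h0 ▸ hc'.rdist_zero_eq hκL
  have hyR : rdist (c 0) (c' κ) < R := by linarith
  set ρ := chart X u v T with hρ
  have hBnorm := hR.dist_eq hcat huv T hz hR.mem_self hyR
  rw [hyκ] at hBnorm
  have hzim : (ρ (c 0)).im = 0 := chart_im_eq_zero huv hf T hz.le
  have hyim : (ρ (c' κ)).im ≤ 0 := by
    rcases chart_im_trichotomy huv hT heT (hR.subset_supp _ hyR) with h1 | h1 | h1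
    · exact absurd (hR.startsIn_of_supp_eq hcat huv hT hc' (h0 ▸ hz) hκ0 hκL.2
        (by rw [← h0, rdist_self]; linarith) h1.1) hnot
    · exact h1.2.le
    · exact h1.2.2.le
  have hlim : Tendsto (fun t => Real.cos (simplexAngle (c 0) (c t) (X.vertexPoint v))) (𝓝[>] 0)
      (𝓝 0) := by
    have := (Real.continuous_cos.tendsto _).comp (hang v (by simp))
    rwa [Real.cos_pi_div_two] at this
  -- near `c 0`, the direction of `c` is perpendicular to the edge up to a small error `η`
  refine le_of_forall_pos_le_add fun θ hθ => ?_
  have hη : 0 < θ / (2 * L * L') := by positivity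
  set η := θ / (2 * L * L') with hηdef
  have hev : ∀ᶠ t in 𝓝[>] (0 : ℝ), t < min ε R :=
    nhdsWithin_le_nhds (eventually_lt_nhds (lt_min hε hRpos))
  obtain ⟨τ, ⟨hcos, hτlt⟩, hτ0⟩ :=
    (((Metric.tendsto_nhds.1 hlim η hη).and hev).and self_mem_nhdsWithin).exists
  replace hτ0 : 0 < τ := hτ0
  rw [lt_min_iff] at hτlt
  have hτL : τ ∈ Icc 0 L := ⟨hτ0.le, hτlt.1.le.trans hεL⟩
  have hxτ := hc.rdist_zero_eq hτL
  have hxR : rdist (c 0) (c τ) < R := by linarith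
  have hxT := hs τ ⟨hτ0, hτlt.1⟩
  have hAnorm := hR.dist_eq hcat huv T hz hR.mem_self hxR
  rw [hxτ] at hAnorm
  rw [cos_simplexAngle huv hT heT hz hxT (by rw [hAnorm]; exact hτ0), hAnorm, Real.dist_eq,
    sub_zero, abs_div, abs_of_pos hτ0, div_lt_iff₀ hτ0] at hcos
  have hxim : 0 ≤ (ρ (c τ)).im := by
    rcases chart_im_trichotomy huv hT heT (hR.subset_supp _ hxR) with h1 | h1 | h1
    · exact h1.2.le
    · exact h1.2.ge
    · exact absurd hxT h1.1
  have sq : ∀ p q : ℂ, dist p q ^ 2 = (p.re - q.re) ^ 2 + (p.im - q.im) ^ 2 := by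
    intro p q
    rw [dist_eq_norm, Complex.sq_norm, Complex.normSq_apply, Complex.sub_re, Complex.sub_im]
    ring
  have hAs := sq (ρ (c 0)) (ρ (c τ))
  have hBs := sq (ρ (c 0)) (ρ (c' κ))
  have hABs := sq (ρ (c τ)) (ρ (c' κ))
  rw [hAnorm, hzim] at hAs
  rw [hBnorm, hzim] at hBs
  have hBre : |(ρ (c' κ)).re - (ρ (c 0)).re| ≤ κ := by
    have := Complex.abs_re_le_norm (ρ (c' κ) - ρ (c 0))
    rwa [← dist_eq_norm, dist_comm, hBnorm, Complex.sub_re] at this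
  -- `c τ` and `c' κ` lie on different sides of the real axis, so their inner product about `c 0`
  -- is at most its part along the axis
  have hprod : ((ρ (c τ)).re - (ρ (c 0)).re) * ((ρ (c' κ)).re - (ρ (c 0)).re) ≤ η * τ * κ := by
    refine (le_abs_self _).trans ?_
    rw [abs_mul]
    exact mul_le_mul hcos.le hBre (abs_nonneg _) (by positivity)
  have hxy := pow_le_pow_left₀ dist_nonneg (hR.dist_le T (c τ) (c' κ) hxR hyR) 2
  have him : (ρ (c τ)).im * (ρ (c' κ)).im ≤ 0 := mul_nonpos_of_nonneg_of_nonpos hxim hyim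
  have hlow : τ ^ 2 + κ ^ 2 - 2 * (η * τ * κ) ≤ rdist (c τ) (c' κ) ^ 2 := by
    refine le_trans ?_ hxy
    rw [hABs]
    nlinarith
  have hcomp := hcat.comparison_sq hL hL' hc hc' h0 hτL hκL
  have h1 := (mul_le_mul_of_nonneg_left hlow (mul_pos hL hL').le).trans hcomp
  have h2 : τ * κ * (L ^ 2 + L' ^ 2 - rdist (c L) (c' L') ^ 2) ≤ τ * κ * (2 * L * L' * η) := by
    linarith
  have h3 := le_of_mul_le_mul_left h2 (mul_pos hτ0 hκ0)
  have h4 : 2 * L * L' * η = θ := by rw [hηdef]; field_simp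
  linarith

/-- If the geodesic from `q` to `x₀` leaves an edge into another triangle than the geodesic `c` from
`q` to `p`, which is perpendicular to the edges at both of its ends, then the geodesic from `p` to
`x₀` starts in the triangle from which `c` arrives. Otherwise the triangle with vertices `x₀`, `q`,
`p` would have two angles that are at least `π / 2`. -/
theorem HeadsInto.cross (hfin : X.FiniteShapesInBalls) (hcat : IsCAT0 X.Realization)
    {u' v' : V} (huv : u ≠ v) (huv' : u' ≠ v') {x₀ : X.Realization} {T T₁ T₂ : Finset V}
    {γ : ℝ → X.Realization} {a b : ℝ} (hγ : IsGeodesic γ a b) (hT : T ≠ T₁)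
    (hstart : StartsPerpendicularly γ a b {u, v} T₁)
    (hend : EndsPerpendicularly γ a b {u', v'} T₂) (h : HeadsInto x₀ (γ a) T) :
    HeadsInto x₀ (γ b) T₂ := by
  obtain ⟨c, L, hL, hc, h0, h1, hs⟩ := h
  have hab : 0 < b - a := by
    obtain ⟨-, -, -, ⟨ε, hε, hεb, -⟩, -⟩ := hstart
    linarith
  have key := hstart.shift.sq_add_sq_le hfin hcat huv hL hγ.shift hc (by simp [h0])
    fun h => hT (hs.eq h fun _ _ => rfl)
  simp only [add_sub_cancel] at key
  rw [h1] at key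
  have hne : γ b ≠ x₀ := by
    intro h
    rw [h, rdist_self] at key
    nlinarith
  obtain ⟨c', hc', h0', h1'⟩ := hcat.exists_isGeodesic (γ b) x₀
  have hpos := hcat.rdist_pos hne
  refine ⟨c', _, hpos, hc', h0', h1', ?_⟩
  by_contra hnot
  have key' := hend.reverse.sq_add_sq_le hfin hcat huv' hpos hγ.reverse hc' (by simp [h0']) hnot
  have hL' : rdist (γ a) x₀ = L := by
    rw [← h0, ← h1]; exact hc.rdist_zero_eq ⟨hL.le, le_rfl⟩
  simp only [sub_sub_cancel] at key'
  rw [h1', hL'] at key'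
  nlinarith

end EuclideanTriangleComplex

end

theorem mainTheorem11 {V : Type*} (X : EuclideanTriangleComplex V)
    (hfin : X.FiniteShapesInBalls) (hcat : IsCAT0 X.Realization)
    (γ : ℝ → X.Realization) (a b : ℝ)
    (hγ : EuclideanTriangleComplex.IsShearedGeodesic γ a b) :
    ¬ IsClosedPath γ a b := by
  classical
  obtain ⟨k, t, e, hk, h0, hb, hgeo, hedge, hmid, hlast⟩ := hγ
  have hpair : ∀ i < k, ∃ u v, u ≠ v ∧ e i = {u, v} := fun i hi =>
    Finset.card_eq_two.1 (hedge i hi).1.2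
  have hslide : ∀ i < k, ∀ T, X.IsTriangle T →
      EuclideanTriangleComplex.HeadsInto (γ a) (γ (t (2 * i + 1))) T →
      EuclideanTriangleComplex.HeadsInto (γ a) (γ (t (2 * i + 2))) T := by
    intro i hi T hT h
    obtain ⟨u, v, huv, he⟩ := hpair i hi
    exact h.slide hfin hcat huv hT (hgeo (2 * i + 1) (by omega))
      fun s hs => ((hedge i hi).2 s hs).trans he
  have main : ∀ i < k, ∀ T,
      EuclideanTriangleComplex.EndsPerpendicularly γ (t (2 * i)) (t (2 * i + 1)) (e i) T →
      EuclideanTriangleComplex.HeadsInto (γ a) (γ (t (2 * i + 1))) T := by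
    intro i
    induction i with
    | zero =>
      intro _ T hT
      have hg := hgeo 0 (by omega)
      obtain ⟨-, -, -, hs, -⟩ := hT.reverse
      refine ⟨_, _, ?_, hg.reverse, by simp, by simp [h0], hs⟩
      obtain ⟨ε, hε, hεL, -⟩ := hs
      simp only [Nat.mul_zero, zero_add] at hεL ⊢
      linarith
    | succ i ih =>
      intro hi T₂ hT₂
      obtain ⟨T, T₁, hne, hend, hstart⟩ := hmid i hi
      obtain ⟨u, v, huv, he⟩ := hpair i (by omega)
      obtain ⟨u', v', huv', he'⟩ := hpair (i + 1) hi
      rw [he] at hstart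
      rw [he'] at hT₂
      exact (hslide i (by omega) T hend.2.1 (ih (by omega) T hend)).cross hfin hcat huv huv'
        (hgeo (2 * i + 2) (by omega)) hne hstart hT₂
  obtain ⟨j, rfl⟩ : ∃ j, k = j + 1 := ⟨k - 1, by omega⟩
  obtain ⟨T, hT⟩ := hlast j rfl
  have hfinal := hslide j (by omega) T hT.2.1 (main j (by omega) T hT)
  rw [show 2 * j + 2 = 2 * (j + 1) by ring, hb] at hfinal
  exact hfinal.ne
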